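/- Let $n \ge 45$ and let $D = (d_1,\dots,d_n)$ be a sequence of non-negative integers whose sum is divisible by $3$. A realization of $D$ is a $3$-uniform hypergraph on $n$ vertices $v_1,\dots,v_n$ (a set of $3$-element subsets of the vertex set, called hyperedges) in which, for every $i$, exactly $d_i$ hyperedges contain $v_i$. (1) If $$\frac{2\lfloor n/3\rfloor^2}{7} + 4\left\lceil \frac n5\right\rceil + 1 \;\le\; d_i \;\le\; \frac{5\lfloor n/3\rfloor^2}{7}\qquad\text{for every } i,$$ then $D$ has a realization. (2) In particular, if $$\frac{2n^2}{63}+\frac{4n}{5}+5 \;\le\; d_i \;\le\; \frac{5n^2}{63}-\frac{20n}{63}\qquad\text{for every } i,$$ then $D$ has a realization. (3) A realization can be constructed in polynomial time: there are a single algorithm (a program for a random access machine with addition and truncated subtraction of natural numbers at unit cost) and a polynomial $T$ such that for every $n\ge 45$ and every $D$ on $n$ vertices with sum divisible by $3$ that satisfies the bounds in (1) or in (2), the algorithm, given $n$ and $D$, halts after at most $T(n)$ steps and outputs a list of the hyperedges of a realization of $D$, each hyperedge exactly once. -/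

import Mathlib

/-! ### Degree sequences of 3-uniform hypergraphs -/

/-- `H` is a 3-uniform hypergraph on the vertex set `{0, …, n - 1}` whose degree sequence is `d`:
every hyperedge has exactly three vertices, and each vertex `v` lies in exactly `d v` hyperedges. -/
def IsRealization {n : ℕ} (d : Fin n → ℕ) (H : Hypergraph (Fin n)) : Prop :=
  H.vertexSet = Set.univ ∧
  (∀ e ∈ H.edgeSet, e.ncard = 3) ∧
  ∀ v : Fin n, {e ∈ H.edgeSet | v ∈ e}.ncard = d v

/-- The sequence `d` is the degree sequence of some 3-uniform hypergraph. -/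
def IsGraphic {n : ℕ} (d : Fin n → ℕ) : Prop :=
  ∃ H : Hypergraph (Fin n), IsRealization d H

/-- Every term of `d` is at least `2⌊n/3⌋²/7 + 4⌈n/5⌉ + 1` and at most `5⌊n/3⌋²/7`. -/
def FloorBounds {n : ℕ} (d : Fin n → ℕ) : Prop :=
  ∀ v : Fin n,
    2 * (⌊(n : ℝ) / 3⌋ : ℝ) ^ 2 / 7 + 4 * (⌈(n : ℝ) / 5⌉ : ℝ) + 1 ≤ (d v : ℝ) ∧
    (d v : ℝ) ≤ 5 * (⌊(n : ℝ) / 3⌋ : ℝ) ^ 2 / 7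

/-- Every term of `d` is at least `2n²/63 + 4n/5 + 5` and at most `5n²/63 - 20n/63`. -/
def SimpleBounds {n : ℕ} (d : Fin n → ℕ) : Prop :=
  ∀ v : Fin n,
    2 * (n : ℝ) ^ 2 / 63 + 4 * (n : ℝ) / 5 + 5 ≤ (d v : ℝ) ∧
    (d v : ℝ) ≤ 5 * (n : ℝ) ^ 2 / 63 - 20 * (n : ℝ) / 63

/-! ### A random access machine with a step count

Structured programs over a random access memory whose cells hold natural numbers. The only
arithmetic is addition and truncated subtraction, each at unit cost, so that the length of the
numbers grows by at most one bit per step (beyond the input and the constants of the program) and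
polynomial time on this machine is polynomial time in the usual sense. -/

namespace RAM

/-- The memory: `s k i` is the content of cell `i` of the array with name `k`. A given program
mentions finitely many arrays only. -/
abbrev Store : Type := ℕ → ℕ → ℕ

/-- Arithmetic expressions. -/
inductive Expr : Type
  /-- a constant -/
  | const (c : ℕ) : Expr
  /-- the content of array `k` at the index given by the value of `i` -/
  | read (k : ℕ) (i : Expr) : Expr
  /-- addition -/
  | add (a b : Expr) : Expr
  /-- truncated subtraction -/
  | sub (a b : Expr) : Expr

namespace Expr

/-- The value of an expression. -/
def eval (s : Store) : Expr → ℕ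
  | const c => c
  | read k i => s k (i.eval s)
  | add a b => a.eval s + b.eval s
  | sub a b => a.eval s - b.eval s

/-- The number of elementary operations that evaluating an expression takes. -/
def cost : Expr → ℕ
  | const _ => 1
  | read _ i => i.cost + 1
  | add a b => a.cost + b.cost + 1
  | sub a b => a.cost + b.cost + 1

end Expr

/-- Programs. -/
inductive Program : Type
  /-- do nothing -/
  | skip : Program
  /-- write the value of `e` into array `k` at the index given by the value of `i` -/
  | write (k : ℕ) (i e : Expr) : Program
  /-- run `p`, then `q` -/
  | seq (p q : Program) : Program
  /-- run `p` if the value of `e` is not zero, and `q` otherwise -/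
  | cond (e : Expr) (p q : Program) : Program
  /-- run `p` again and again as long as the value of `e` is not zero -/
  | loop (e : Expr) (p : Program) : Program

/-- `Run p s s' t`: started on the memory `s`, the program `p` halts with the memory `s'` after
exactly `t` steps. -/
inductive Run : Program → Store → Store → ℕ → Prop
  | skip (s : Store) : Run Program.skip s s 1
  | write (k : ℕ) (i e : Expr) (s : Store) :
      Run (Program.write k i e) s
        (Function.update s k (Function.update (s k) (i.eval s) (e.eval s)))
        (i.cost + e.cost + 1)
  | seq {p q : Program} {s s' s'' : Store} {a b : ℕ} :
      Run p s s' a → Run q s' s'' b → Run (Program.seq p q) s s'' (a + b)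
  | cond_true {e : Expr} {p q : Program} {s s' : Store} {a : ℕ} :
      e.eval s ≠ 0 → Run p s s' a → Run (Program.cond e p q) s s' (e.cost + 1 + a)
  | cond_false {e : Expr} {p q : Program} {s s' : Store} {a : ℕ} :
      e.eval s = 0 → Run q s s' a → Run (Program.cond e p q) s s' (e.cost + 1 + a)
  | loop_done {e : Expr} {p : Program} {s : Store} :
      e.eval s = 0 → Run (Program.loop e p) s s (e.cost + 1)
  | loop_again {e : Expr} {p : Program} {s s' s'' : Store} {a b : ℕ} :
      e.eval s ≠ 0 → Run p s s' a → Run (Program.loop e p) s' s'' b →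
      Run (Program.loop e p) s s'' (e.cost + 1 + a + b)

/-- The initial memory for the sequence `d` on `n` vertices: `n` in cell 0 of array 0, the terms
of `d` in the first `n` cells of array 1, and zeros everywhere else. -/
def input {n : ℕ} (d : Fin n → ℕ) : Store
  | 0, 0 => n
  | 1, i => if h : i < n then d ⟨i, h⟩ else 0
  | _, _ => 0

/-- The memory `s` holds a list of the hyperedges of `H`, each of them exactly once: cell 0 of
array 2 is the number of hyperedges, and the vertices of the hyperedge with index `t` are in
cell `t` of the arrays 3, 4 and 5. -/
def Holds {n : ℕ} (s : Store) (H : Hypergraph (Fin n)) : Prop :=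
  ∃ f : Fin (s 2 0) → Set (Fin n),
    Function.Injective f ∧ Set.range f = H.edgeSet ∧
    ∀ t, Fin.val '' f t = {s 3 t, s 4 t, s 5 t}

end RAM

/-!
# Degree sequences of 3-uniform hypergraphs within an interval

Write `m = ⌊n/3⌋` and let `N` be a third of the sum of the required degrees `D`. The realization is
found in two phases.

Sort the vertices by decreasing required degree and take the first `N` triples of positions in
colexicographic order. For some `K` this list contains all triples of positions below `K` and uses
no position beyond `K` (`ColexPrefix`). Since `N ≤ (K + 1).choose 3`, and the lower bounds on the
degrees force `N` to exceed `2 m ^ 3 / 7`, the number `(K - 1).choose 2` is at least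
`5 m ^ 2 / 7` (`DegreeBounds.le_choose`): in the complete hypergraph on the first `K` vertices every
degree is at least as large as required. The constants fit because `(10/7) ^ (3/2) / 6 < 2/7`:
a complete hypergraph with degrees `5 m ^ 2 / 7` has fewer than `2 m ^ 3 / 7` edges, up to terms of
lower order, which the summand `4 ⌈n/5⌉` makes up for. Hence the degrees that are
too large belong to positions up to `K`, those that are too small to positions from `K` on, and
by the sorting `D j ≤ D i` whenever the degree of `i` is too large and that of `j` too small.

This property survives when an edge is moved from such an `i` to such a `j`, that is, when `i` is
replaced by `j` in an edge that contains `i` but not `j`. An edge that can be moved without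
creating a repetition exists because the current degree of `i` is larger than that of `j`
(`exists_shift`): `deg j < D j ≤ D i < deg i`. Every move decreases the total excess, so after at
most `3 N` moves all degrees are right (`Shiftable`).

The two phases are carried out by `RAM.realizationProgram`, and the existence statements are read
off from its correctness. Programs are verified with `RAM.Exec`, total correctness within a given
number of steps: loop-free pieces are evaluated symbolically, loops have an invariant indexed by a
bound on the remaining iterations (`RAM.Exec.loop`), and `RAM.Run.frame` says that arrays a
program does not mention on the left of an assignment keep their contents.

The memory is laid out as follows. Arrays `0` to `5` hold the input and the output, array `6` the
current degrees, array `7` the sorted vertices; the arrays from `8` on are scalar variables.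
-/

/-! ### Running programs: total correctness with a step bound -/

namespace RAM

namespace Expr

/-- The content of cell `0` of array `k`, used as a scalar variable. -/
def var (k : ℕ) : Expr := read k (const 0)

/-- The successor of `a`. -/
def succ (a : Expr) : Expr := add a (const 1)

/-- Nonzero exactly if `a < b`. -/
def lt (a b : Expr) : Expr := sub b a

/-- Nonzero exactly if `a = 0`. -/
def not (a : Expr) : Expr := sub (const 1) a

/-- Nonzero exactly if `a ≠ 0` or `b ≠ 0`. -/
def or (a b : Expr) : Expr := add a b

/-- Nonzero exactly if `a ≠ 0` and `b ≠ 0`. -/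
def and (a b : Expr) : Expr := not (or (not a) (not b))

/-- Nonzero exactly if `a = b`. -/
def eq (a b : Expr) : Expr := not (or (lt a b) (lt b a))

/-- Nonzero exactly if `x` is one of the three vertices of the edge with index `t`. -/
def mem (x t : Expr) : Expr :=
  or (or (eq x (read 3 t)) (eq x (read 4 t))) (eq x (read 5 t))

variable (s : Store) (a b x t : Expr) (k : ℕ)

@[simp] lemma eval_const (c : ℕ) : (const c).eval s = c := rfl
@[simp] lemma eval_read : (read k a).eval s = s k (a.eval s) := rfl
@[simp] lemma eval_add : (add a b).eval s = a.eval s + b.eval s := rfl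
@[simp] lemma eval_sub : (sub a b).eval s = a.eval s - b.eval s := rfl
@[simp] lemma eval_var : (var k).eval s = s k 0 := rfl
@[simp] lemma eval_succ : (succ a).eval s = a.eval s + 1 := rfl

@[simp] lemma eval_lt : (lt a b).eval s = 0 ↔ ¬ a.eval s < b.eval s := by
  simp [lt, Nat.sub_eq_zero_iff_le]

@[simp] lemma eval_not : (not a).eval s = 0 ↔ a.eval s ≠ 0 := by
  simp only [not, eval_sub, eval_const]; omega

@[simp] lemma eval_or : (or a b).eval s = 0 ↔ a.eval s = 0 ∧ b.eval s = 0 := by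
  simp [or]

@[simp] lemma eval_and : (and a b).eval s = 0 ↔ a.eval s = 0 ∨ b.eval s = 0 := by
  simp only [and, eval_not, ne_eq, eval_or]; tauto

@[simp] lemma eval_eq : (eq a b).eval s = 0 ↔ a.eval s ≠ b.eval s := by
  simp only [eq, eval_not, ne_eq, eval_or, eval_lt]; omega

end Expr

namespace Program

/-- The arrays a program may write to. -/
def writes : Program → List ℕ
  | skip => []
  | write k _ _ => [k]
  | seq p q => p.writes ++ q.writes
  | cond _ p q => p.writes ++ q.writes
  | loop _ p => p.writes

/-- The program contains no loop. -/
def LoopFree : Program → Bool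
  | skip => true
  | write _ _ _ => true
  | seq p q => p.LoopFree && q.LoopFree
  | cond _ p q => p.LoopFree && q.LoopFree
  | loop _ _ => false

/-- The memory after running a loop-free program (a loop is treated as `skip`). -/
def result : Program → Store → Store
  | skip, s => s
  | write k i e, s => fun k' j => if k' = k ∧ j = i.eval s then e.eval s else s k' j
  | seq p q, s => q.result (p.result s)
  | cond e p q, s => if e.eval s = 0 then q.result s else p.result s
  | loop _ _, s => s

/-- A bound on the running time of a loop-free program. -/
def maxCost : Program → ℕ
  | skip => 1
  | write _ i e => i.cost + e.cost + 1
  | seq p q => p.maxCost + q.maxCost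
  | cond e p q => e.cost + 1 + (p.maxCost + q.maxCost)
  | loop _ _ => 0

lemma run_result {p : Program} (hp : p.LoopFree = true) (s : Store) :
    ∃ t ≤ p.maxCost, Run p s (p.result s) t := by
  induction p generalizing s with
  | skip => exact ⟨1, le_rfl, Run.skip s⟩
  | write k i e =>
    refine ⟨_, le_rfl, ?_⟩
    suffices h : (write k i e).result s =
        Function.update s k (Function.update (s k) (i.eval s) (e.eval s)) from
      h ▸ Run.write k i e s
    funext k' j
    by_cases hk : k' = k
    · subst hk
      by_cases hj : j = i.eval s <;> simp [result, hj]
    · simp [result, hk]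
  | seq p q ihp ihq =>
    simp only [LoopFree, Bool.and_eq_true] at hp
    obtain ⟨a, ha, hra⟩ := ihp hp.1 s
    obtain ⟨b, hb, hrb⟩ := ihq hp.2 (p.result s)
    exact ⟨a + b, Nat.add_le_add ha hb, hra.seq hrb⟩
  | cond e p q ihp ihq =>
    simp only [LoopFree, Bool.and_eq_true] at hp
    by_cases he : e.eval s = 0
    · obtain ⟨b, hb, hrb⟩ := ihq hp.2 s
      refine ⟨_, ?_, by simpa [result, he] using Run.cond_false he hrb⟩
      simp only [maxCost]; omega
    · obtain ⟨a, ha, hra⟩ := ihp hp.1 s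
      refine ⟨_, ?_, by simpa [result, he] using Run.cond_true he hra⟩
      simp only [maxCost]; omega
  | loop e p => simp [LoopFree] at hp

end Program

/-- A program changes only the arrays it writes to. -/
lemma Run.frame {p : Program} {s s' : Store} {t : ℕ} (h : Run p s s' t) :
    ∀ k ∉ p.writes, s' k = s k := by
  induction h with
  | skip | loop_done => intros; rfl
  | write k i e s =>
    intro k' hk'
    simp only [Program.writes, List.mem_singleton] at hk'
    simp [hk']
  | seq _ _ ih₁ ih₂ =>
    intro k hk
    simp only [Program.writes, List.mem_append, not_or] at hk
    rw [ih₂ k hk.2, ih₁ k hk.1]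
  | cond_true _ _ ih | cond_false _ _ ih =>
    intro k hk
    simp only [Program.writes, List.mem_append, not_or] at hk
    first | exact ih k hk.1 | exact ih k hk.2
  | loop_again _ _ _ ih₁ ih₂ =>
    intro k hk
    rw [ih₂ k hk, ih₁ k hk]

/-- Started on `s`, the program `p` halts after at most `T` steps with a memory that satisfies
`Q`. -/
def Exec (p : Program) (s : Store) (T : ℕ) (Q : Store → Prop) : Prop :=
  ∃ s' t, Run p s s' t ∧ t ≤ T ∧ Q s'

namespace Exec

variable {p q : Program} {e : Expr} {s : Store} {T T' : ℕ} {Q R : Store → Prop}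

lemma mono (h : Exec p s T Q) (hT : T ≤ T') (hQ : ∀ s', Q s' → R s') : Exec p s T' R := by
  obtain ⟨s', t, hr, ht, hq⟩ := h
  exact ⟨s', t, hr, ht.trans hT, hQ s' hq⟩

lemma frame (h : Exec p s T Q) : Exec p s T fun s' => Q s' ∧ ∀ k ∉ p.writes, s' k = s k := by
  obtain ⟨s', t, hr, ht, hq⟩ := h
  exact ⟨s', t, hr, ht, hq, hr.frame⟩

lemma of_loopFree (hp : p.LoopFree = true) (hT : p.maxCost ≤ T) (hQ : Q (p.result s)) :
    Exec p s T Q := by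
  obtain ⟨t, ht, hr⟩ := Program.run_result hp s
  exact ⟨_, t, hr, ht.trans hT, hQ⟩

lemma seq (hp : Exec p s T R)
    (hq : ∀ s', R s' → (∀ k ∉ p.writes, s' k = s k) → Exec q s' T' Q) :
    Exec (Program.seq p q) s (T + T') Q := by
  obtain ⟨s', t, hr, ht, h, hf⟩ := hp.frame
  obtain ⟨s'', t', hr', ht', h'⟩ := hq s' h hf
  exact ⟨s'', t + t', hr.seq hr', Nat.add_le_add ht ht', h'⟩

lemma cond (hp : e.eval s ≠ 0 → Exec p s T Q) (hq : e.eval s = 0 → Exec q s T Q) :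
    Exec (Program.cond e p q) s (e.cost + 1 + T) Q := by
  by_cases he : e.eval s = 0
  · obtain ⟨s', t, hr, ht, h⟩ := hq he
    exact ⟨s', _, .cond_false he hr, by omega, h⟩
  · obtain ⟨s', t, hr, ht, h⟩ := hp he
    exact ⟨s', _, .cond_true he hr, by omega, h⟩

/-- The rule for loops. The invariant `I` is indexed by a bound `k` on the number of iterations
that are still to come. Inside the body, the arrays that the body does not write to may be assumed
to be as they were before the loop. -/
lemma loop {B k : ℕ} (I : ℕ → Store → Prop) (h0 : I k s)
    (hstep : ∀ k s', I k s' → (∀ j ∉ p.writes, s' j = s j) → e.eval s' ≠ 0 →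
      Exec p s' B fun s'' => ∃ k' < k, I k' s'') :
    Exec (Program.loop e p) s (k * (e.cost + 1 + B) + (e.cost + 1))
      fun s' => e.eval s' = 0 ∧ ∃ k', I k' s' := by
  suffices H : ∀ k s', I k s' → (∀ j ∉ p.writes, s' j = s j) →
      Exec (Program.loop e p) s' (k * (e.cost + 1 + B) + (e.cost + 1))
        fun s' => e.eval s' = 0 ∧ ∃ k', I k' s' from H k s h0 fun _ _ => rfl
  intro k
  induction k using Nat.strong_induction_on with
  | _ k ih =>
    intro s' hI hf
    by_cases he : e.eval s' = 0
    · exact ⟨s', _, .loop_done he, by omega, he, k, hI⟩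
    · obtain ⟨s₁, t₁, hr₁, ht₁, ⟨k', hk', hI'⟩, hf₁⟩ := (hstep k s' hI hf he).frame
      obtain ⟨s₂, t₂, hr₂, ht₂, hQ⟩ := ih k' hk' s₁ hI' fun j hj => (hf₁ j hj).trans (hf j hj)
      refine ⟨s₂, _, .loop_again he hr₁ hr₂, ?_, hQ⟩
      have : (k' + 1) * (e.cost + 1 + B) ≤ k * (e.cost + 1 + B) := Nat.mul_le_mul_right _ hk'
      rw [Nat.add_mul] at this
      omega

end Exec

namespace Program

/-- Run `p` with the scalar variable `i` counting from `0` up to the value of the scalar variable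
`N`, exclusively. -/
def forLoop (i N : ℕ) (p : Program) : Program :=
  seq (write i (.const 0) (.const 0))
    (loop (.lt (.var i) (.var N)) (seq p (write i (.const 0) (.succ (.var i)))))

end Program

/-- The rule for counting loops. The invariant must not depend on the counter `i` in the memory;
its value is the index of the invariant. -/
lemma Exec.forLoop {p : Program} {s : Store} {B n i N : ℕ} (I : ℕ → Store → Prop)
    (hN : s N 0 = n) (hNp : N ∉ p.writes) (hip : i ∉ p.writes) (hiN : N ≠ i)
    (hI : ∀ j s₁ s₂, (∀ k ≠ i, s₂ k = s₁ k) → I j s₁ → I j s₂) (h0 : I 0 s)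
    (hstep : ∀ j s', j < n → I j s' → s' i 0 = j → (∀ k ∉ p.writes, k ≠ i → s' k = s k) →
      Exec p s' B (I (j + 1))) :
    Exec (Program.forLoop i N p) s (n * (B + 12) + 9) (I n) := by
  have hinit : Exec (.write i (.const 0) (.const 0)) s 3
      fun s' => s' i 0 = 0 ∧ ∀ k ≠ i, s' k = s k := by
    refine .of_loopFree rfl le_rfl ⟨by simp [Program.result], fun k hk => ?_⟩
    simp [Program.result, hk]
  have hwr : ∀ k, k ∉ (p.seq (.write i (.const 0) (.succ (.var i)))).writes ↔
      k ∉ p.writes ∧ k ≠ i := by simp [Program.writes]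
  refine (hinit.seq (T' := n * (B + 12) + 6) (Q := I n) fun s₀ hs₀ _ => ?_).mono (by omega)
    fun _ => id
  have key := Exec.loop (p := p.seq (.write i (.const 0) (.succ (.var i))))
    (e := .lt (.var i) (.var N)) (s := s₀) (B := B + 6) (k := n)
    (fun k s' => s' N 0 = n ∧ s' i 0 + k = n ∧ I (s' i 0) s') ⟨?_, ?_, ?_⟩ ?_
  · refine key.mono ?_ ?_
    · have : (Expr.lt (.var i) (.var N)).cost = 5 := rfl
      rw [this, show 5 + 1 + (B + 6) = B + 12 by omega]
    · rintro s' ⟨he, k, hn, hk, hI'⟩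
      simp only [Expr.eval_lt, Expr.eval_var] at he
      have : s' i 0 = n := by omega
      rwa [this] at hI'
  · rw [hs₀.2 N hiN, hN]
  · omega
  · rw [hs₀.1]
    exact hI 0 s s₀ hs₀.2 h0
  · rintro k s' ⟨hn, hk, hI'⟩ hf he
    simp only [ne_eq, Expr.eval_lt, Expr.eval_var, not_not] at he
    refine (hstep _ s' (by omega) hI' rfl fun k hk hki => ?_).seq fun s₁ hs₁ hf₁ => ?_
    · rw [hf k ((hwr k).2 ⟨hk, hki⟩), hs₀.2 k hki]
    · have hs₁i : s₁ i 0 = s' i 0 := by rw [hf₁ i hip]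
      have hs₁N : s₁ N 0 = n := by rw [hf₁ N hNp, hn]
      refine .of_loopFree rfl le_rfl ⟨k - 1, by omega, ?_, ?_, ?_⟩
      · simp [Program.result, hiN, hs₁N]
      · simp only [Program.result, Expr.eval_const, Expr.eval_succ, Expr.eval_var, and_self,
          if_true]
        omega
      · have : (Program.write i (.const 0) (.succ (.var i))).result s₁ i 0 = s' i 0 + 1 := by
          simp [Program.result, hs₁i]
        rw [this]
        refine hI _ s₁ _ (fun k hk => ?_) hs₁
        simp [Program.result, hk]

end RAM

/-! ### Degrees in a list of sets, and shifting an edge -/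

open Finset

/-- The degree of `v` in the list `E 0, …, E (N - 1)` of finite sets. -/
def listDegree (E : ℕ → Finset ℕ) (N v : ℕ) : ℕ := #{t ∈ range N | v ∈ E t}

lemma listDegree_zero (E : ℕ → Finset ℕ) (v : ℕ) : listDegree E 0 v = 0 := by
  simp [listDegree]

lemma listDegree_succ (E : ℕ → Finset ℕ) (N v : ℕ) :
    listDegree E (N + 1) v = listDegree E N v + if v ∈ E N then 1 else 0 := by
  simp only [listDegree, card_filter, sum_range_succ]

lemma listDegree_le (E : ℕ → Finset ℕ) (N v : ℕ) : listDegree E N v ≤ N :=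
  (card_filter_le _ _).trans (card_range N).le

/-- The effect on degrees of replacing a single member of the list. -/
lemma listDegree_replace {E E' : ℕ → Finset ℕ} {N t : ℕ} (ht : t < N)
    (h : ∀ u ≠ t, E' u = E u) (v : ℕ) :
    listDegree E' N v + (if v ∈ E t then 1 else 0) =
      listDegree E N v + if v ∈ E' t then 1 else 0 := by
  simp only [listDegree, card_filter]
  rw [← add_sum_erase _ _ (mem_range.2 ht), ← add_sum_erase (range N) _ (mem_range.2 ht)]
  have : ∑ u ∈ (range N).erase t, (if v ∈ E' u then 1 else 0) =
      ∑ u ∈ (range N).erase t, if v ∈ E u then 1 else 0 :=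
    sum_congr rfl fun u hu => by rw [h u (ne_of_mem_erase hu)]
  omega

lemma sum_listDegree {E : ℕ → Finset ℕ} {N n : ℕ} (hcard : ∀ t < N, #(E t) = 3)
    (hsub : ∀ t < N, E t ⊆ range n) : ∑ v ∈ range n, listDegree E N v = 3 * N := by
  simp only [listDegree, card_filter]
  rw [sum_comm]
  have : ∀ t ∈ range N, (∑ v ∈ range n, if v ∈ E t then 1 else 0) = 3 := by
    intro t ht
    rw [← card_filter, filter_mem_eq_inter, inter_eq_right.2 (hsub t (mem_range.1 ht)),
      hcard t (mem_range.1 ht)]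
  rw [sum_congr rfl this]
  simp [mul_comm]

/-- If `i` has a larger degree than `j`, then some edge through `i` can be moved to `j` without
creating a repeated edge: otherwise moving edges would be an injection from the edges through `i`
that avoid `j` to the edges through `j` that avoid `i`. -/
lemma exists_shift {E : ℕ → Finset ℕ} {N i j : ℕ}
    (hinj : ∀ t < N, ∀ u < N, E t = E u → t = u)
    (hlt : listDegree E N j < listDegree E N i) :
    ∃ t < N, i ∈ E t ∧ j ∉ E t ∧ ∀ u < N, E u ≠ insert j ((E t).erase i) := by
  by_contra! hcon
  have hij : i ≠ j := by rintro rfl; exact lt_irrefl _ hlt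
  choose! φ hφN hφ using hcon
  have hle : #{t ∈ range N | i ∈ E t ∧ j ∉ E t} ≤ #{t ∈ range N | j ∈ E t ∧ i ∉ E t} := by
    refine card_le_card_of_injOn φ ?_ ?_
    · intro t ht
      simp only [coe_filter, mem_range, Set.mem_ofPred_eq] at ht ⊢
      refine ⟨hφN t ht.1 ht.2.1 ht.2.2, ?_⟩
      rw [hφ t ht.1 ht.2.1 ht.2.2]
      simp [hij]
    · intro t ht u hu htu
      simp only [coe_filter, mem_range, Set.mem_ofPred_eq] at ht hu
      refine hinj t ht.1 u hu.1 ?_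
      have h := (hφ t ht.1 ht.2.1 ht.2.2).symm.trans
        ((congrArg E htu).trans (hφ u hu.1 hu.2.1 hu.2.2))
      have h' := congrArg (fun s => insert i (s.erase j)) h
      simpa [erase_insert, ht.2.1, hu.2.1, ht.2.2, hu.2.2, insert_erase] using h'
  have split : ∀ a b, listDegree E N a =
      #{t ∈ range N | a ∈ E t ∧ b ∉ E t} + #{t ∈ range N | a ∈ E t ∧ b ∈ E t} := by
    intro a b
    rw [listDegree, ← card_filter_add_card_filter_not (p := fun t => b ∈ E t), filter_filter,
      filter_filter, add_comm]
  have hcomm : #{t ∈ range N | j ∈ E t ∧ i ∈ E t} = #{t ∈ range N | i ∈ E t ∧ j ∈ E t} := by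
    simp only [and_comm]
  have h₁ := split i j
  have h₂ := split j i
  omega

/-! ### Sorting by counting -/

/-- The order in which vertices are listed: by decreasing required degree, ties broken by index. -/
def Before (D : ℕ → ℕ) (u v : ℕ) : Prop := D v < D u ∨ D u = D v ∧ u < v

instance (D : ℕ → ℕ) (u v : ℕ) : Decidable (Before D u v) := by
  unfold Before; infer_instance

/-- The number of vertices below `n` that come before `v`. -/
def rank (D : ℕ → ℕ) (n v : ℕ) : ℕ := #{u ∈ range n | Before D u v}

lemma rank_lt_rank {D : ℕ → ℕ} {n u v : ℕ} (hu : u < n) (h : Before D u v) :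
    rank D n u < rank D n v := by
  unfold rank
  refine card_lt_card ((ssubset_iff_of_subset fun w hw => ?_).2
    ⟨u, mem_filter.2 ⟨mem_range.2 hu, h⟩, fun hs => ?_⟩)
  · simp only [mem_filter, mem_range] at hw ⊢
    unfold Before at *
    omega
  · simp only [mem_filter] at hs
    unfold Before at hs
    omega

lemma rank_injective {D : ℕ → ℕ} {n u v : ℕ} (hu : u < n) (hv : v < n)
    (h : rank D n u = rank D n v) : u = v := by
  by_contra hne
  have : Before D u v ∨ Before D v u := by unfold Before; omega
  rcases this with h' | h'
  · exact (rank_lt_rank hu h').ne h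
  · exact (rank_lt_rank hv h').ne h.symm

lemma rank_lt {D : ℕ → ℕ} {n v : ℕ} (hv : v < n) : rank D n v < n := by
  have : #{u ∈ range n | Before D u v} < #(range n) := by
    refine card_lt_card (filter_ssubset.2 ⟨v, mem_range.2 hv, ?_⟩)
    simp [Before]
  simpa [rank] using this

/-- `p 0, …, p (n - 1)` lists the vertices below `n` by decreasing value of `D`. -/
structure IsSorting (D : ℕ → ℕ) (n : ℕ) (p : ℕ → ℕ) : Prop where
  lt : ∀ k < n, p k < n
  inj : ∀ k < n, ∀ l < n, p k = p l → k = l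
  surj : ∀ v < n, ∃ k < n, p k = v
  anti : ∀ k l, k ≤ l → l < n → D (p l) ≤ D (p k)

lemma IsSorting.of_rank {D : ℕ → ℕ} {n : ℕ} {p : ℕ → ℕ} (h : ∀ v < n, p (rank D n v) = v) :
    IsSorting D n p := by
  have hsurj : ∀ k < n, ∃ v < n, rank D n v = k := by
    have := surjOn_of_injOn_of_card_le (s := range n) (t := range n) (rank D n)
      (fun v hv => by simpa using rank_lt (by simpa using hv))
      (fun u hu v hv huv => rank_injective (by simpa using hu) (by simpa using hv) huv) le_rfl
    intro k hk
    obtain ⟨v, hv, hvk⟩ := this (by simpa using hk : k ∈ ((range n : Finset ℕ) : Set ℕ))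
    exact ⟨v, by simpa using hv, hvk⟩
  refine ⟨?_, ?_, fun v hv => ⟨_, rank_lt hv, h v hv⟩, ?_⟩
  · intro k hk
    obtain ⟨v, hv, rfl⟩ := hsurj k hk
    rwa [h v hv]
  · intro k hk l hl hkl
    obtain ⟨v, hv, rfl⟩ := hsurj k hk
    obtain ⟨w, hw, rfl⟩ := hsurj l hl
    rw [h v hv, h w hw] at hkl
    rw [hkl]
  · intro k l hkl hl
    obtain ⟨v, hv, rfl⟩ := hsurj k (hkl.trans_lt hl)
    obtain ⟨w, hw, rfl⟩ := hsurj l hl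
    rw [h v hv, h w hw]
    by_contra! hlt
    exact (rank_lt_rank hw (Or.inl hlt)).not_ge hkl

/-! ### Cliques on an initial segment of the sorted vertices -/

lemma card_image_triple {n : ℕ} {p : ℕ → ℕ} (hp : ∀ k < n, ∀ l < n, p k = p l → k = l)
    {x y z : ℕ} (hxy : x < y) (hyz : y < z) (hz : z < n) : #{p x, p y, p z} = 3 := by
  refine card_eq_three.2 ⟨p x, p y, p z, fun h => ?_, fun h => ?_, fun h => ?_, rfl⟩
  · have := hp _ (by omega) _ (by omega) h; omega
  · have := hp _ (by omega) _ (by omega) h; omega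
  · have := hp _ (by omega) _ (by omega) h; omega

/-- If every triple of positions below `K` occurs in the list, a vertex at such a position has at
least the degree it has in the complete hypergraph on `K` vertices. -/
lemma choose_le_listDegree {E : ℕ → Finset ℕ} {N n K k : ℕ} {p : ℕ → ℕ}
    (hp : ∀ k < n, ∀ l < n, p k = p l → k = l) (hK : K ≤ n)
    (hall : ∀ s ⊆ range K, #s = 3 → ∃ t < N, E t = s.image p) (hk : k < K) :
    (K - 1).choose 2 ≤ listDegree E N (p k) := by
  have hcard : #(powersetCard 2 ((range K).erase k)) = (K - 1).choose 2 := by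
    rw [card_powersetCard, card_erase_of_mem (mem_range.2 hk), card_range]
  have hall' : ∀ s ∈ powersetCard 2 ((range K).erase k), ∃ t < N, E t = (insert k s).image p := by
    intro s hs
    rw [mem_powersetCard] at hs
    have hks : k ∉ s := fun h => notMem_erase k (range K) (hs.1 h)
    refine hall _ (insert_subset (mem_range.2 hk) (hs.1.trans (erase_subset _ _))) ?_
    rw [card_insert_of_notMem hks, hs.2]
  choose! φ hφN hφ using hall'
  rw [← hcard]
  refine card_le_card_of_injOn φ ?_ ?_
  · intro s hs
    simp only [coe_filter, mem_range, Set.mem_ofPred_eq]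
    refine ⟨hφN s hs, ?_⟩
    rw [hφ s hs]
    exact mem_image_of_mem p (mem_insert_self k s)
  · intro s hs s' hs' h
    have himg : (insert k s).image p = (insert k s').image p := by
      rw [← hφ s hs, h, hφ s' hs']
    rw [mem_coe, mem_powersetCard] at hs hs'
    have hsub : ∀ u ⊆ (range K).erase k, ∀ x ∈ insert k u, x < n := fun u hu x hx =>
      (mem_range.1 (insert_subset (mem_range.2 hk) (hu.trans (erase_subset _ _)) hx)).trans_le hK
    have hle : ∀ u ⊆ (range K).erase k, ∀ u' ⊆ (range K).erase k,
        (insert k u).image p = (insert k u').image p → insert k u ⊆ insert k u' := by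
      intro u hu u' hu' h x hx
      obtain ⟨y, hy, hyx⟩ := mem_image.1 (h ▸ mem_image_of_mem p hx)
      rwa [← hp y (hsub u' hu' y hy) x (hsub u hu x hx) hyx]
    have hins : insert k s = insert k s' :=
      (hle s hs.1 s' hs'.1 himg).antisymm (hle s' hs'.1 s hs.1 himg.symm)
    rw [← erase_insert (fun h => notMem_erase k (range K) (hs.1 h)), hins,
      erase_insert (fun h => notMem_erase k (range K) (hs'.1 h))]

lemma card_le_choose_of_subset {E : ℕ → Finset ℕ} {N : ℕ} {V : Finset ℕ}
    (hinj : ∀ t < N, ∀ u < N, E t = E u → t = u) (hcard : ∀ t < N, #(E t) = 3)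
    (hsub : ∀ t < N, E t ⊆ V) : N ≤ (#V).choose 3 := by
  rw [← card_powersetCard, ← card_range N]
  refine card_le_card_of_injOn E ?_ ?_
  · intro t ht
    have ht : t < N := by simpa using ht
    exact mem_powersetCard.2 ⟨hsub t ht, hcard t ht⟩
  · intro t ht u hu h
    exact hinj t (by simpa using ht) u (by simpa using hu) h

lemma choose_le_card_of_forall {E : ℕ → Finset ℕ} {N n : ℕ} {p : ℕ → ℕ}
    (hp : ∀ k < n, ∀ l < n, p k = p l → k = l)
    (hall : ∀ s ⊆ range n, #s = 3 → ∃ t < N, E t = s.image p) : n.choose 3 ≤ N := by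
  have hcard : #(powersetCard 3 ((range n).image p)) = n.choose 3 := by
    rw [card_powersetCard, card_image_of_injOn, card_range]
    exact fun a ha b hb hab => hp a (by simpa using ha) b (by simpa using hb) hab
  rw [← hcard, ← card_range N]
  refine card_le_card_of_surjOn E ?_
  intro s hs
  rw [mem_coe, mem_powersetCard] at hs
  obtain ⟨u, hu, rfl⟩ := subset_image_iff.1 hs.1
  have hinj : Set.InjOn p u := fun a ha b hb hab =>
    hp a (by simpa using hu ha) b (by simpa using hu hb) hab
  obtain ⟨t, ht, hEt⟩ := hall u (by simpa using hu) (by rw [← card_image_of_injOn hinj, hs.2])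
  exact ⟨t, by simpa using ht, hEt⟩

/-! ### The numerical estimate -/

/-- Bounds on the values of `D` below `n` with a real parameter `m`, which will be `⌊n/3⌋`. -/
structure DegreeBounds (D : ℕ → ℕ) (n : ℕ) (m : ℝ) : Prop where
  le_m : 15 ≤ m
  m_le : 3 * m ≤ n
  lower : ∀ v < n, 2 * m ^ 2 / 7 + 12 * m / 5 + 1 ≤ (D v : ℝ)
  upper : ∀ v < n, (D v : ℝ) ≤ 5 * m ^ 2 / 7

lemma six_mul_choose_three (K : ℕ) :
    6 * (((K + 1).choose 3 : ℕ) : ℝ) = (K + 1) * K * (K - 1) := by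
  have h := Nat.add_one_mul_choose_eq K 2
  have h' : ((K + 1 : ℕ) : ℝ) * (K.choose 2 : ℕ) = ((K + 1).choose 3 : ℕ) * 3 := by
    exact_mod_cast h
  rw [Nat.cast_choose_two] at h'
  push_cast at h'
  linarith

/-- The values of `D` are at most the degree of a vertex in the complete hypergraph on `K` vertices,
if the number of edges is less than that of the complete hypergraph on `K + 1` vertices. This is
where the constants enter: for `K` close to `√(10/7) m` the complete hypergraph has degrees
close to `5 m ^ 2 / 7` and `(10/7) ^ (3/2) m ^ 3 / 6 ≈ 0.28458 m ^ 3` edges, while the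
lower bounds force more than `2 m ^ 3 / 7 ≈ 0.28571 m ^ 3` edges. -/
lemma DegreeBounds.le_choose {D : ℕ → ℕ} {n N K : ℕ} {m : ℝ} (h : DegreeBounds D n m)
    (hsum : ∑ v ∈ range n, D v = 3 * N) (hN : N ≤ (K + 1).choose 3) {v : ℕ} (hv : v < n) :
    D v ≤ (K - 1).choose 2 := by
  have hm := h.le_m
  have hlow : (n : ℝ) * (2 * m ^ 2 / 7 + 12 * m / 5 + 1) ≤ 3 * (N : ℝ) := by
    have h₁ : ∑ v ∈ range n, (2 * m ^ 2 / 7 + 12 * m / 5 + 1) ≤ ∑ v ∈ range n, (D v : ℝ) :=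
      sum_le_sum fun v hv => h.lower v (mem_range.1 hv)
    rw [sum_const, card_range, nsmul_eq_mul] at h₁
    exact h₁.trans (by exact_mod_cast hsum.le)
  have hlow' : 3 * m * (2 * m ^ 2 / 7 + 12 * m / 5 + 1) ≤
      (n : ℝ) * (2 * m ^ 2 / 7 + 12 * m / 5 + 1) :=
    mul_le_mul_of_nonneg_right h.m_le (by positivity)
  have hN' : 6 * (N : ℝ) ≤ (K + 1) * K * (K - 1) := by
    rw [← six_mul_choose_three]
    have : (N : ℝ) ≤ ((K + 1).choose 3 : ℕ) := by exact_mod_cast hN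
    linarith
  have hK : 1 ≤ K := by
    rcases Nat.eq_zero_or_pos K with rfl | hK
    · have : 0 < 3 * m * (2 * m ^ 2 / 7 + 12 * m / 5 + 1) := by positivity
      simp only [Nat.cast_zero, mul_zero, zero_mul] at hN'
      linarith
    · exact hK
  by_contra! hlt
  have hlt' : (((K - 1).choose 2 : ℕ) : ℝ) < 5 * m ^ 2 / 7 :=
    lt_of_lt_of_le (by exact_mod_cast hlt) (h.upper v hv)
  rw [Nat.cast_choose_two, Nat.cast_sub hK, Nat.cast_one] at hlt'
  have hK0 : (0 : ℝ) ≤ K := Nat.cast_nonneg K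
  -- completing the square: `(K - 1) (K - 2) = (K - 3/2) ^ 2 - 1/4`
  have hKm : (K : ℝ) < 1.1953 * m + 1.6 := by
    by_contra! hge
    nlinarith [mul_self_le_mul_self (by positivity : 0 ≤ 1.1953 * m + 0.1)
      (by linarith : 1.1953 * m + 0.1 ≤ (K : ℝ) - 1.5)]
  have hcube : (K : ℝ) ^ 3 ≤ (1.1953 * m + 1.6) ^ 3 := pow_le_pow_left₀ hK0 hKm.le 3
  nlinarith [mul_nonneg (sub_nonneg.2 hm) (sq_nonneg m),
    mul_nonneg (sub_nonneg.2 hm) (sub_nonneg.2 hm), pow_nonneg (by linarith : 0 ≤ m) 3]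

lemma DegreeBounds.le_choose_three {D : ℕ → ℕ} {n N : ℕ} {m : ℝ} (h : DegreeBounds D n m)
    (hsum : ∑ v ∈ range n, D v = 3 * N) : N ≤ n.choose 3 := by
  have hm := h.le_m
  have hn : (45 : ℝ) ≤ n := by linarith [h.m_le]
  obtain ⟨k, rfl⟩ : ∃ k, n = k + 1 := ⟨n - 1, by
    have : 45 ≤ n := by exact_mod_cast hn
    omega⟩
  have hup : 3 * (N : ℝ) ≤ ((k + 1 : ℕ) : ℝ) * (5 * m ^ 2 / 7) := by
    have h₁ : ∑ v ∈ range (k + 1), (D v : ℝ) ≤ ∑ v ∈ range (k + 1), 5 * m ^ 2 / 7 :=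
      sum_le_sum fun v hv => h.upper v (mem_range.1 hv)
    rw [sum_const, card_range, nsmul_eq_mul] at h₁
    exact le_trans (by exact_mod_cast hsum.ge) h₁
  have h6 := six_mul_choose_three k
  have hle := h.m_le
  push_cast at hup hn hle
  have hsq : 5 * m ^ 2 / 7 ≤ (k : ℝ) * (k - 1) / 2 := by nlinarith
  have := mul_le_mul_of_nonneg_left hsq (by linarith : (0 : ℝ) ≤ k + 1)
  have : (N : ℝ) ≤ ((k + 1).choose 3 : ℕ) := by nlinarith
  exact_mod_cast this

lemma FloorBounds.degreeBounds {n : ℕ} {d : Fin n → ℕ} (hn : 45 ≤ n) (h : FloorBounds d)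
    {D : ℕ → ℕ} (hD : ∀ v : Fin n, D v = d v) : DegreeBounds D n (⌊(n : ℝ) / 3⌋ : ℝ) := by
  have hle : ((⌊(n : ℝ) / 3⌋ : ℤ) : ℝ) ≤ (n : ℝ) / 3 := Int.floor_le _
  have hceil : (n : ℝ) / 5 ≤ (⌈(n : ℝ) / 5⌉ : ℤ) := Int.le_ceil _
  have hn' : (45 : ℝ) ≤ n := by exact_mod_cast hn
  refine ⟨?_, by linarith, fun v hv => ?_, fun v hv => ?_⟩
  · have : (15 : ℤ) ≤ ⌊(n : ℝ) / 3⌋ := Int.le_floor.2 (by push_cast; linarith)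
    exact_mod_cast this
  · have := (h ⟨v, hv⟩).1
    rw [← hD] at this
    linarith
  · have := (h ⟨v, hv⟩).2
    rwa [← hD] at this

lemma SimpleBounds.floorBounds {n : ℕ} {d : Fin n → ℕ} (hn : 45 ≤ n) (h : SimpleBounds d) :
    FloorBounds d := by
  have hle : ((⌊(n : ℝ) / 3⌋ : ℤ) : ℝ) ≤ (n : ℝ) / 3 := Int.floor_le _
  have hn' : (45 : ℝ) ≤ n := by exact_mod_cast hn
  -- rounding loses at most `2/3` in `n / 3` and at most `4/5` in `n / 5`
  have hge : ((n : ℝ) - 2) / 3 ≤ (⌊(n : ℝ) / 3⌋ : ℤ) := by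
    have h3 : n < 3 * (n / 3 + 1) := by omega
    have : ((n / 3 : ℕ) : ℤ) ≤ ⌊(n : ℝ) / 3⌋ := Int.le_floor.2 (by
      push_cast; exact_mod_cast Nat.cast_div_le)
    have h' := (Int.cast_le (R := ℝ)).2 this
    rw [Int.cast_natCast] at h'
    have h'' : (n : ℝ) ≤ 3 * ((n / 3 : ℕ) : ℝ) + 2 := by exact_mod_cast (by omega)
    linarith
  have hceil : ((⌈(n : ℝ) / 5⌉ : ℤ) : ℝ) ≤ ((n : ℝ) + 4) / 5 := by
    have : ⌈(n : ℝ) / 5⌉ ≤ (((n + 4) / 5 : ℕ) : ℤ) := Int.ceil_le.2 (by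
      have : (n : ℝ) ≤ 5 * (((n + 4) / 5 : ℕ) : ℝ) := by exact_mod_cast (by omega)
      rw [Int.cast_natCast]
      linarith)
    have h' := (Int.cast_le (R := ℝ)).2 this
    rw [Int.cast_natCast] at h'
    refine h'.trans ?_
    have : 5 * (((n + 4) / 5 : ℕ) : ℝ) ≤ n + 4 := by exact_mod_cast (by omega)
    linarith
  intro v
  obtain ⟨h₁, h₂⟩ := h v
  constructor <;> nlinarith

namespace RAM

open Program RAM.Expr

/-! ### The sum of the degrees and the sorting of the vertices -/

/-- Add up the required degrees into the scalar `8`. -/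
def sumProgram : Program :=
  forLoop 9 0 (write 8 (const 0) (add (var 8) (read 1 (var 9))))

lemma exec_sumProgram {s : Store} {n : ℕ} (hn : s 0 0 = n) (h8 : s 8 0 = 0) :
    Exec sumProgram s (n * 30 + 9) fun s' => s' 8 0 = ∑ v ∈ range n, s 1 v := by
  refine (Exec.forLoop (B := 18) (fun j s' => s' 8 0 = ∑ v ∈ range j, s 1 v) hn (by decide)
    (by decide) (by decide) ?_ (by simpa using h8) ?_).mono (by omega) fun _ => id
  · intro j s₁ s₂ hs h
    rw [hs 8 (by decide), h]
  · intro j s' _ hI hj hf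
    refine .of_loopFree rfl (by decide) ?_
    have h1 : s' 1 = s 1 := hf 1 (by decide) (by decide)
    simp [result, hI, hj, h1, sum_range_succ]

/-- Nonzero exactly if vertex `u` comes before vertex `v` in the sorted order. -/
def beforeExpr (u v : Expr) : Expr :=
  or (lt (read 1 v) (read 1 u)) (and (eq (read 1 u) (read 1 v)) (lt u v))

lemma eval_beforeExpr (s : Store) (u v : Expr) :
    (beforeExpr u v).eval s ≠ 0 ↔ Before (s 1) (u.eval s) (v.eval s) := by
  simp only [beforeExpr, Before, ne_eq, eval_or, eval_and, eval_lt, eval_eq, eval_read]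
  tauto

/-- Count in the scalar `11` the vertices that come before the vertex in the scalar `9`. -/
def rankProgram : Program :=
  forLoop 10 0 (.cond (beforeExpr (var 10) (var 9)) (write 11 (const 0) (succ (var 11))) skip)

lemma exec_rankProgram {s : Store} {n : ℕ} (hn : s 0 0 = n) (h11 : s 11 0 = 0) :
    Exec rankProgram s (n * 60 + 9) fun s' => s' 11 0 = rank (s 1) n (s 9 0) := by
  refine (Exec.forLoop (B := 48)
    (fun j s' => s' 11 0 = #{u ∈ range j | Before (s 1) u (s 9 0)}) hn (by decide)
    (by decide) (by decide) ?_ (by simpa using h11) ?_).mono (by omega) fun _ => id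
  · intro j s₁ s₂ hs h
    rw [hs 11 (by decide), h]
  · intro j s' _ hI hj hf
    have h1 : s' 1 = s 1 := hf 1 (by decide) (by decide)
    have h9 : s' 9 = s 9 := hf 9 (by decide) (by decide)
    have hiff := eval_beforeExpr s' (var 10) (var 9)
    simp only [eval_var, h1, h9, hj] at hiff
    rw [card_filter] at hI
    refine .of_loopFree rfl (by decide) ?_
    rw [card_filter, sum_range_succ]
    by_cases hb : Before (s 1) j (s 9 0)
    · have := hiff.2 hb
      simp [result, this, hb, hI]
    · have : (beforeExpr (var 10) (var 9)).eval s' = 0 := by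
        by_contra h
        exact hb (hiff.1 h)
      simp [result, this, hb, hI]

/-- List the vertices in array `7` by decreasing required degree. -/
def sortProgram : Program :=
  forLoop 9 0
    (seq (write 11 (const 0) (const 0)) (seq rankProgram (write 7 (var 11) (var 9))))

lemma exec_sortProgram {s : Store} {n : ℕ} (hn : s 0 0 = n) :
    Exec sortProgram s (n * (n * 60 + 40) + 9) fun s' => IsSorting (s 1) n (s' 7) := by
  refine (Exec.forLoop (B := 3 + (n * 60 + 9 + 5))
    (fun j s' => ∀ v < j, v < n → s' 7 (rank (s 1) n v) = v) hn (by decide)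
    (by decide) (by decide) ?_ (by simp) ?_).mono
      (Nat.add_le_add_right (Nat.mul_le_mul_left _ (by omega)) _)
      fun s' h => IsSorting.of_rank fun v hv => h v hv hv
  · intro j s₁ s₂ hs h
    rw [hs 7 (by decide)]
    exact h
  · intro j s' hjn hI hj hf
    have h0 : s' 0 = s 0 := hf 0 (by decide) (by decide)
    have h1 : s' 1 = s 1 := hf 1 (by decide) (by decide)
    refine Exec.seq (T := 3) (R := fun s'' => s'' 11 0 = 0)
      (.of_loopFree rfl (by decide) (by simp [result])) fun s₁ hs₁ hf₁ => ?_
    have h10 : s₁ 0 = s' 0 := hf₁ 0 (by decide)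
    have h11 : s₁ 1 = s' 1 := hf₁ 1 (by decide)
    have h17 : s₁ 7 = s' 7 := hf₁ 7 (by decide)
    have h19 : s₁ 9 = s' 9 := hf₁ 9 (by decide)
    refine Exec.seq (exec_rankProgram (by rw [h10, h0, hn]) hs₁) fun s₂ hs₂ hf₂ => ?_
    have h27 : s₂ 7 = s₁ 7 := hf₂ 7 (by decide)
    have h29 : s₂ 9 = s₁ 9 := hf₂ 9 (by decide)
    refine .of_loopFree rfl (by decide) fun v hv hvn => ?_
    simp only [result, eval_var, hs₂, h29, h19, hj, h11, h1, true_and, h27, h17]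
    by_cases hvj : v = j
    · simp [hvj]
    · rw [if_neg fun h => hvj (rank_injective hvn hjn h)]
      exact hI v (by omega) hvn

/-! ### Computing degrees -/

/-- The vertex set of the edge with index `t`. -/
def edge (s : Store) (t : ℕ) : Finset ℕ := {s 3 t, s 4 t, s 5 t}

lemma edge_congr {s s' : Store} (h3 : s' 3 = s 3) (h4 : s' 4 = s 4) (h5 : s' 5 = s 5) :
    edge s' = edge s := by
  funext t
  simp only [edge, h3, h4, h5]

lemma eval_mem (s : Store) (x t : Expr) :
    (mem x t).eval s = 0 ↔ x.eval s ∉ edge s (t.eval s) := by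
  simp [mem, edge, and_assoc]

lemma edge_ne_of_card {s : Store} {t : ℕ} (h : #(edge s t) = 3) :
    s 3 t ≠ s 4 t ∧ s 3 t ≠ s 5 t ∧ s 4 t ≠ s 5 t := by
  unfold edge at h
  refine ⟨fun h' => ?_, fun h' => ?_, fun h' => ?_⟩ <;> rw [h'] at h
  · have := card_le_two (a := s 4 t) (b := s 5 t)
    simp at h
    omega
  · have := card_le_two (a := s 4 t) (b := s 5 t)
    rw [insert_eq_of_mem (by simp)] at h
    omega
  · have := card_le_two (a := s 3 t) (b := s 5 t)
    simp at h
    omega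

/-- Increase cell `e` of array `6`. -/
def incr (e : Expr) : Program := write 6 e (succ (read 6 e))

/-- Compute the degrees of all vertices in array `6`. -/
def degreeProgram : Program :=
  forLoop 15 2
    (seq (incr (read 3 (var 15))) (seq (incr (read 4 (var 15))) (incr (read 5 (var 15)))))

lemma exec_degreeProgram {s : Store} {N : ℕ} (hN : s 2 0 = N) (h6 : ∀ v, s 6 v = 0)
    (hcard : ∀ t < N, #(edge s t) = 3) :
    Exec degreeProgram s (N * 50 + 9) fun s' => ∀ v, s' 6 v = listDegree (edge s) N v := by
  refine (Exec.forLoop (B := 38) (fun j s' => ∀ v, s' 6 v = listDegree (edge s) j v) hN (by decide)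
    (by decide) (by decide) ?_ (by simpa [listDegree_zero] using h6) ?_).mono (by omega) fun _ => id
  · intro j s₁ s₂ hs h
    rw [hs 6 (by decide)]
    exact h
  · intro j s' hjN hI hj hf
    have h3 : s' 3 = s 3 := hf 3 (by decide) (by decide)
    have h4 : s' 4 = s 4 := hf 4 (by decide) (by decide)
    have h5 : s' 5 = s 5 := hf 5 (by decide) (by decide)
    refine .of_loopFree rfl (by decide) fun v => ?_
    obtain ⟨h34, h35, h45⟩ := edge_ne_of_card (hcard j hjN)
    rw [listDegree_succ, ← hI v]
    simp only [result, incr, eval_read, eval_var, eval_succ, hj, h3, h4, h5, true_and, edge,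
      mem_insert, mem_singleton, show (15 : ℕ) ≠ 6 by decide,
      show (4 : ℕ) ≠ 6 by decide, show (5 : ℕ) ≠ 6 by decide, false_and, if_false]
    by_cases hv3 : v = s 3 j
    · subst hv3
      simp [h34, h35]
    · by_cases hv4 : v = s 4 j
      · subst hv4
        simp [h34.symm, h45]
      · by_cases hv5 : v = s 5 j
        · subst hv5
          simp [h35.symm, h45.symm]
        · simp [hv3, hv4, hv5]

end RAM

/-! ### An initial segment of the triples in colexicographic order -/

/-- For `x < y < z` and `a < b < c`: the triple `x, y, z` comes before `a, b, c` in the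
colexicographic order. -/
def ColexLT (x y z a b c : ℕ) : Prop := z < c ∨ z = c ∧ (y < b ∨ y = b ∧ x < a)

/-- The list `E 0, …, E (N - 1)` of triples when the triples before `a, b, c` have been processed,
each of them being appended as long as `3 * N < S`. Positions are translated to vertices by `p`.
The field `clique` is what matters in the end: for some `K`, all triples of positions below
`K` are in the list and only positions up to `K` are used. -/
structure ColexPrefix (p : ℕ → ℕ) (n S : ℕ) (E : ℕ → Finset ℕ) (N a b c : ℕ) : Prop where
  edges : ∀ t < N, ∃ x y z, x < y ∧ y < z ∧ z < n ∧ ColexLT x y z a b c ∧ E t = {p x, p y, p z}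
  inj : ∀ t < N, ∀ u < N, E t = E u → t = u
  le : 3 * N ≤ S
  clique : ∃ K ≤ c, (∀ x y z, x < y → y < z → z < K → ∃ t < N, E t = {p x, p y, p z}) ∧
    (∀ t < N, E t ⊆ (range (K + 1)).image p) ∧
    (3 * N = S ∨ K = c ∧ ∀ x y z, x < y → y < z → ColexLT x y z a b c →
      ∃ t < N, E t = {p x, p y, p z})

namespace ColexPrefix

variable {p : ℕ → ℕ} {n S N a b c : ℕ} {E E' : ℕ → Finset ℕ}

lemma init : ColexPrefix p n S E 0 0 0 0 where
  edges := by simp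
  inj := by simp
  le := by simp
  clique := by
    refine ⟨0, le_rfl, by simp, by simp, Or.inr ⟨rfl, fun x y z _ _ h => ?_⟩⟩
    simp [ColexLT] at h

/-- The end of a run of the innermost loop. -/
lemma next_b (h : ColexPrefix p n S E N b b c) : ColexPrefix p n S E N 0 (b + 1) c := by
  obtain ⟨K, hK, hall, hsub, hor⟩ := h.clique
  refine ⟨fun t ht => ?_, h.inj, h.le, K, hK, hall, hsub, hor.imp id fun ⟨hKc, h'⟩ => ⟨hKc, ?_⟩⟩
  · obtain ⟨x, y, z, hxy, hyz, hz, hlt, he⟩ := h.edges t ht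
    exact ⟨x, y, z, hxy, hyz, hz, by unfold ColexLT at *; omega, he⟩
  · intro x y z hxy hyz hlt
    exact h' x y z hxy hyz (by unfold ColexLT at *; omega)

/-- The end of a run of the middle loop. -/
lemma next_c (h : ColexPrefix p n S E N 0 c c) : ColexPrefix p n S E N 0 0 (c + 1) := by
  have hedges : ∀ t < N, ∃ x y z, x < y ∧ y < z ∧ z < n ∧ ColexLT x y z 0 0 (c + 1) ∧
      E t = {p x, p y, p z} := by
    intro t ht
    obtain ⟨x, y, z, hxy, hyz, hz, hlt, he⟩ := h.edges t ht
    exact ⟨x, y, z, hxy, hyz, hz, by unfold ColexLT at *; omega, he⟩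
  obtain ⟨K, hK, hall, hsub, hor⟩ := h.clique
  rcases hor with hS | ⟨rfl, h'⟩
  · exact ⟨hedges, h.inj, h.le, K, by omega, hall, hsub, Or.inl hS⟩
  · refine ⟨hedges, h.inj, h.le, K + 1, le_rfl, ?_, ?_, Or.inr ⟨rfl, ?_⟩⟩
    · exact fun x y z hxy hyz hz => h' x y z hxy hyz (by unfold ColexLT; omega)
    · exact fun t ht => (hsub t ht).trans (image_subset_image (range_subset_range.2 (by omega)))
    · exact fun x y z hxy hyz hz => h' x y z hxy hyz (by unfold ColexLT at *; omega)

/-- No triple is appended once the number of edges has been reached. -/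
lemma skip (h : ColexPrefix p n S E N a b c) (hS : ¬ 3 * N < S) :
    ColexPrefix p n S E N (a + 1) b c := by
  obtain ⟨K, hK, hall, hsub, -⟩ := h.clique
  have := h.le
  refine ⟨fun t ht => ?_, h.inj, h.le, K, hK, hall, hsub, Or.inl (by omega)⟩
  obtain ⟨x, y, z, hxy, hyz, hz, hlt, he⟩ := h.edges t ht
  exact ⟨x, y, z, hxy, hyz, hz, by unfold ColexLT at *; omega, he⟩

lemma append (h : ColexPrefix p n S E N a b c)
    (hp : ∀ k < n, ∀ l < n, p k = p l → k = l) (habc : a < b ∧ b < c ∧ c < n)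
    (hS : 3 * N < S) (h3 : 3 ∣ S) (hE : ∀ t < N, E' t = E t) (hN : E' N = {p a, p b, p c}) :
    ColexPrefix p n S E' (N + 1) (a + 1) b c := by
  obtain ⟨hab, hbc, hcn⟩ := habc
  have hnew : ∀ t < N, E' t ≠ E' N := by
    intro t ht heq
    rw [hE t ht, hN] at heq
    obtain ⟨x, y, z, hxy, hyz, hz, hlt, he⟩ := h.edges t ht
    rw [he] at heq
    have hmem : ∀ w < n, w = x ∨ w = y ∨ w = z → w = a ∨ w = b ∨ w = c := by
      intro w hw hwx
      have : p w ∈ ({p a, p b, p c} : Finset ℕ) := by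
        rw [← heq]
        rcases hwx with rfl | rfl | rfl <;> simp
      simp only [mem_insert, mem_singleton] at this
      exact this.imp (hp w hw a (by omega)) (Or.imp (hp w hw b (by omega)) (hp w hw c (by omega)))
    have hx := hmem x (by omega) (by simp)
    have hy := hmem y (by omega) (by simp)
    have hz' := hmem z hz (by simp)
    unfold ColexLT at hlt
    omega
  have hold : ∀ {x y z}, (∃ t < N, E t = {p x, p y, p z}) →
      ∃ t < N + 1, E' t = {p x, p y, p z} := by
    rintro x y z ⟨t, ht, he⟩
    exact ⟨t, by omega, (hE t ht).trans he⟩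
  obtain ⟨K, hK, hall, hsub, hor⟩ := h.clique
  obtain ⟨rfl, h'⟩ : K = c ∧ _ := hor.resolve_left hS.ne
  refine ⟨?_, ?_, by omega, K, le_rfl, fun x y z hxy hyz hz => hold (hall x y z hxy hyz hz), ?_,
    Or.inr ⟨rfl, ?_⟩⟩
  · intro t ht
    rcases Nat.lt_succ_iff_lt_or_eq.1 ht with ht | rfl
    · obtain ⟨x, y, z, hxy, hyz, hz, hlt, he⟩ := h.edges t ht
      exact ⟨x, y, z, hxy, hyz, hz, by unfold ColexLT at *; omega, (hE t ht).trans he⟩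
    · exact ⟨a, b, K, hab, hbc, hcn, by unfold ColexLT; omega, hN⟩
  · intro t ht u hu htu
    rcases Nat.lt_succ_iff_lt_or_eq.1 ht with ht | rfl <;>
      rcases Nat.lt_succ_iff_lt_or_eq.1 hu with hu | rfl
    · exact h.inj t ht u hu (by rw [← hE t ht, ← hE u hu, htu])
    · exact absurd htu (hnew t ht)
    · exact absurd htu.symm (hnew u hu)
    · rfl
  · intro t ht
    rcases Nat.lt_succ_iff_lt_or_eq.1 ht with ht | rfl
    · rw [hE t ht]
      exact hsub t ht
    · rw [hN]
      simp only [insert_subset_iff, singleton_subset_iff]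
      exact ⟨mem_image_of_mem p (mem_range.2 (by omega)),
        mem_image_of_mem p (mem_range.2 (by omega)), mem_image_of_mem p (mem_range.2 (by omega))⟩
  · intro x y z hxy hyz hlt
    by_cases hlt' : ColexLT x y z a b K
    · exact hold (h' x y z hxy hyz hlt')
    · obtain ⟨rfl, rfl, rfl⟩ : x = a ∧ y = b ∧ z = K := by unfold ColexLT at *; omega
      exact ⟨N, by omega, hN⟩

end ColexPrefix

namespace RAM

open Program RAM.Expr

/-- Append the triple of positions in the scalars `14`, `13`, `12` to the list of edges. -/
def appendProgram : Program :=
  seq (write 3 (var 2) (read 7 (var 14))) (seq (write 4 (var 2) (read 7 (var 13)))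
    (seq (write 5 (var 2) (read 7 (var 12))) (write 2 (const 0) (succ (var 2)))))

/-- List triples of positions in colexicographic order until there are as many edges as a third of
the scalar `8`. -/
def colexProgram : Program :=
  forLoop 12 0 (forLoop 13 12 (forLoop 14 13
    (.cond (lt (add (add (var 2) (var 2)) (var 2)) (var 8)) appendProgram skip)))

lemma exec_colexProgram {s : Store} {n S : ℕ} (hn : s 0 0 = n) (h2 : s 2 0 = 0) (h8 : s 8 0 = S)
    (h3 : 3 ∣ S) (hp : ∀ k < n, ∀ l < n, s 7 k = s 7 l → k = l) :
    Exec colexProgram s (n * (n * (n * 80 + 30) + 30) + 9)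
      fun s' => ColexPrefix (s 7) n S (edge s') (s' 2 0) 0 0 n := by
  have hcongr : ∀ i, i ≠ 2 → i ≠ 3 → i ≠ 4 → i ≠ 5 → ∀ a b c (s₁ s₂ : Store),
      (∀ k ≠ i, s₂ k = s₁ k) → ColexPrefix (s 7) n S (edge s₁) (s₁ 2 0) a b c →
      ColexPrefix (s 7) n S (edge s₂) (s₂ 2 0) a b c := by
    intro i hi2 hi3 hi4 hi5 a b c s₁ s₂ hs h
    rwa [edge_congr (hs 3 hi3.symm) (hs 4 hi4.symm) (hs 5 hi5.symm), hs 2 hi2.symm]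
  refine (Exec.forLoop (B := n * (n * 80 + 30) + 9)
    (fun c s' => ColexPrefix (s 7) n S (edge s') (s' 2 0) 0 0 c) hn (by decide) (by decide)
    (by decide) (fun c => hcongr 12 (by decide) (by decide) (by decide) (by decide) 0 0 c)
    (by rw [h2]; exact .init) ?_).mono
      (Nat.add_le_add_right (Nat.mul_le_mul_left _ (by omega)) _) fun _ => id
  intro c s₁ hc hI₁ hc₁ hf₁
  have h17 : s₁ 7 = s 7 := hf₁ 7 (by decide) (by decide)
  have h18 : s₁ 8 = s 8 := hf₁ 8 (by decide) (by decide)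
  refine (Exec.forLoop (B := n * 80 + 9)
    (fun b s' => ColexPrefix (s 7) n S (edge s') (s' 2 0) 0 b c) hc₁ (by decide) (by decide)
    (by decide) (fun b => hcongr 13 (by decide) (by decide) (by decide) (by decide) 0 b c)
    hI₁ ?_).mono
      (Nat.add_le_add_right (Nat.mul_le_mul hc.le (by omega)) _) fun _ h => h.next_c
  intro b s₂ hb hI₂ hb₂ hf₂
  have h27 : s₂ 7 = s₁ 7 := hf₂ 7 (by decide) (by decide)
  have h28 : s₂ 8 = s₁ 8 := hf₂ 8 (by decide) (by decide)
  have h2c : s₂ 12 = s₁ 12 := hf₂ 12 (by decide) (by decide)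
  refine (Exec.forLoop (B := 68)
    (fun a s' => ColexPrefix (s 7) n S (edge s') (s' 2 0) a b c) hb₂ (by decide) (by decide)
    (by decide) (fun a => hcongr 14 (by decide) (by decide) (by decide) (by decide) a b c)
    hI₂ ?_).mono
      (Nat.add_le_add_right (Nat.mul_le_mul (hb.trans hc).le le_rfl) _) fun _ h => h.next_b
  intro a s₃ ha hI₃ ha₃ hf₃
  have h37 : s₃ 7 = s₂ 7 := hf₃ 7 (by decide) (by decide)
  have h38 : s₃ 8 = s₂ 8 := hf₃ 8 (by decide) (by decide)
  have h3b : s₃ 13 = s₂ 13 := hf₃ 13 (by decide) (by decide)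
  have h3c : s₃ 12 = s₂ 12 := hf₃ 12 (by decide) (by decide)
  refine .of_loopFree rfl (by decide) ?_
  have he : (lt (add (add (var 2) (var 2)) (var 2)) (var 8)).eval s₃ = 0 ↔
      ¬ 3 * s₃ 2 0 < S := by
    simp only [eval_lt, eval_add, eval_var, h38, h28, h18, h8]
    omega
  by_cases hlt : 3 * s₃ 2 0 < S
  · rw [result, if_neg fun h => he.1 h hlt]
    have hres2 : appendProgram.result s₃ 2 0 = s₃ 2 0 + 1 := by simp [appendProgram, result]
    rw [hres2]
    refine hI₃.append hp ⟨ha, hb, hc⟩ hlt h3 (fun t ht => ?_) ?_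
    · simp [edge, appendProgram, result, ht.ne]
    · simp [edge, appendProgram, result, h37, h27, h17, h3b, h3c, h2c, ha₃, hb₂, hc₁]
  · rw [result, if_pos (he.2 hlt)]
    exact hI₃.skip hlt

end RAM

/-! ### Shifting edges until all degrees are right -/

/-- The invariant of the shifting phase: `E 0, …, E (N - 1)` are distinct 3-element subsets of
`{0, …, n - 1}`, in number as the required degrees `D` demand, and no vertex whose degree is too
large has a smaller required degree than a vertex whose degree is too small. -/
structure Shiftable (D : ℕ → ℕ) (n N : ℕ) (E : ℕ → Finset ℕ) : Prop where
  card : ∀ t < N, #(E t) = 3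
  sub : ∀ t < N, E t ⊆ range n
  inj : ∀ t < N, ∀ u < N, E t = E u → t = u
  sum : ∑ v ∈ range n, D v = 3 * N
  le : ∀ i < n, ∀ j < n, D i < listDegree E N i → listDegree E N j < D j → D j ≤ D i

/-- The edge with index `t` can be moved from `i` to `j` without creating a repeated edge. -/
def Movable (E : ℕ → Finset ℕ) (N i j t : ℕ) : Prop :=
  i ∈ E t ∧ j ∉ E t ∧ ∀ u < N, E u ≠ insert j ((E t).erase i)

namespace Shiftable

variable {D : ℕ → ℕ} {n N i j t : ℕ} {E E' : ℕ → Finset ℕ}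

/-- The list produced by the colexicographic phase satisfies the invariant: the vertices at the
first `K` positions have at least the required degree, those after position `K` have degree
zero, and the positions are sorted by required degree. -/
lemma of_colexPrefix {p : ℕ → ℕ} {m : ℝ} (hD : DegreeBounds D n m) (hp : IsSorting D n p)
    (h3 : 3 ∣ ∑ v ∈ range n, D v)
    (h : ColexPrefix p n (∑ v ∈ range n, D v) E N 0 0 n) : Shiftable D n N E := by
  obtain ⟨M, hM⟩ := h3
  have hcard : ∀ t < N, #(E t) = 3 := by
    intro t ht
    obtain ⟨x, y, z, hxy, hyz, hz, -, he⟩ := h.edges t ht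
    rw [he]
    exact card_image_triple hp.inj hxy hyz hz
  have hsub : ∀ t < N, E t ⊆ range n := by
    intro t ht
    obtain ⟨x, y, z, hxy, hyz, hz, -, he⟩ := h.edges t ht
    rw [he]
    simp only [insert_subset_iff, singleton_subset_iff, mem_range]
    exact ⟨hp.lt x (by omega), hp.lt y (by omega), hp.lt z hz⟩
  -- sorted triples of positions and 3-element sets of positions are the same thing
  have htriple : ∀ K : ℕ, (∀ x y z, x < y → y < z → z < K → ∃ t < N, E t = {p x, p y, p z}) →
      ∀ s ⊆ range K, #s = 3 → ∃ t < N, E t = s.image p := by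
    intro K hK s hs hs3
    have hmem : ∀ k, s.orderEmbOfFin hs3 k < K := fun k =>
      mem_range.1 (hs (s.orderEmbOfFin_mem hs3 k))
    obtain ⟨t, ht, he⟩ := hK (s.orderEmbOfFin hs3 0) (s.orderEmbOfFin hs3 1)
      (s.orderEmbOfFin hs3 2) (by simp) (by simp) (hmem 2)
    refine ⟨t, ht, ?_⟩
    rw [he, ← congrArg (Finset.image p) (image_orderEmbOfFin_univ s hs3), image_image]
    ext x
    simp [Fin.exists_fin_succ, eq_comm]
  obtain ⟨K, hK, hall, hsubK, hor⟩ := h.clique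
  have hsum : ∑ v ∈ range n, D v = 3 * N := by
    rcases hor with hS | ⟨rfl, -⟩
    · exact hS.symm
    · have h₁ := choose_le_card_of_forall hp.inj (htriple K hall)
      have h₂ := hD.le_choose_three hM
      have h₃ := h.le
      omega
  have hN : N ≤ (K + 1).choose 3 := by
    have h₁ := card_le_choose_of_subset h.inj hcard hsubK
    refine h₁.trans (Nat.choose_le_choose 3 ?_)
    exact card_image_le.trans (card_range _).le
  refine ⟨hcard, hsub, h.inj, hsum, fun i hi j hj hdi hdj => ?_⟩
  obtain ⟨k, hk, rfl⟩ := hp.surj i hi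
  obtain ⟨l, hl, rfl⟩ := hp.surj j hj
  refine hp.anti k l ?_ hl
  have hKl : K ≤ l := by
    by_contra! hlt
    have h₁ := choose_le_listDegree hp.inj hK (htriple K hall) hlt
    have h₂ := hD.le_choose hsum hN (hp.lt l hl)
    omega
  have hkK : k ≤ K := by
    by_contra! hlt
    have : listDegree E N (p k) = 0 := by
      rw [listDegree, card_eq_zero, filter_eq_empty_iff]
      intro t ht hmem
      obtain ⟨w, hw, hwk⟩ := mem_image.1 (hsubK t (mem_range.1 ht) hmem)
      rw [mem_range] at hw
      have := hp.inj w (by omega) k hk hwk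
      omega
    omega
  omega

/-- As the sum of the degrees is right, a degree that is too large entails one that is too
small. -/
lemma exists_under (h : Shiftable D n N E) (hi : i < n) (hdi : D i < listDegree E N i) :
    ∃ j < n, listDegree E N j < D j := by
  by_contra! hcon
  have := sum_lt_sum (s := range n) (fun v hv => hcon v (mem_range.1 hv))
    ⟨i, mem_range.2 hi, hdi⟩
  rw [h.sum, sum_listDegree h.card h.sub] at this
  exact lt_irrefl _ this

lemma exists_movable (h : Shiftable D n N E) (hi : i < n) (hj : j < n)
    (hdi : D i < listDegree E N i) (hdj : listDegree E N j < D j) :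
    ∃ t < N, Movable E N i j t :=
  exists_shift h.inj ((hdj.trans_le (h.le i hi j hj hdi hdj)).trans hdi)

/-- Degrees after moving the edge with index `t` from `i` to `j`. -/
lemma _root_.Movable.listDegree (hm : Movable E N i j t) (ht : t < N)
    (hE : ∀ u ≠ t, E' u = E u) (hEt : E' t = insert j ((E t).erase i)) (v : ℕ) :
    listDegree E' N v =
      if v = i then listDegree E N v - 1 else if v = j then listDegree E N v + 1
      else listDegree E N v := by
  have key := listDegree_replace ht hE v
  have hij : i ≠ j := fun h => hm.2.1 (h ▸ hm.1)
  rw [hEt] at key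
  simp only [mem_insert, mem_erase] at key
  by_cases hvi : v = i
  · subst hvi
    simp only [hm.1, hij, if_true, ne_eq, not_true, false_and, or_false, if_false] at key ⊢
    omega
  · by_cases hvj : v = j
    · subst hvj
      simp only [hm.2.1, hvi, if_true, if_false, true_or] at key ⊢
      omega
    · simp only [hvi, hvj, if_false, ne_eq, not_false_eq_true, true_and, false_or] at key ⊢
      omega

lemma move (h : Shiftable D n N E) (hj : j < n) (ht : t < N) (hm : Movable E N i j t)
    (hdi : D i < listDegree E N i) (hdj : listDegree E N j < D j)
    (hE : ∀ u ≠ t, E' u = E u) (hEt : E' t = insert j ((E t).erase i)) :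
    Shiftable D n N E' := by
  have hdeg := hm.listDegree ht hE hEt
  obtain ⟨hit, hjt, hfree⟩ := hm
  refine ⟨fun u hu => ?_, fun u hu => ?_, fun u hu w hw huw => ?_, h.sum, ?_⟩
  · by_cases hut : u = t
    · rw [hut, hEt, card_insert_of_notMem fun hmem => hjt (mem_of_mem_erase hmem),
        card_erase_of_mem hit, h.card t ht]
    · rw [hE u hut, h.card u hu]
  · by_cases hut : u = t
    · rw [hut, hEt]
      exact insert_subset (mem_range.2 hj) ((erase_subset _ _).trans (h.sub t ht))
    · rw [hE u hut]
      exact h.sub u hu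
  · by_cases hut : u = t <;> by_cases hwt : w = t
    · rw [hut, hwt]
    · rw [hut, hEt, hE w hwt] at huw
      exact absurd huw.symm (hfree w hw)
    · rw [hwt, hEt, hE u hut] at huw
      exact absurd huw (hfree u hu)
    · rw [hE u hut, hE w hwt] at huw
      exact h.inj u hu w hw huw
  · intro k hk l hl hdk hdl
    refine h.le k hk l hl ?_ ?_
    · rw [hdeg] at hdk
      split_ifs at hdk with h₁ h₂
      · omega
      · subst h₂; omega
      · exact hdk
    · rw [hdeg] at hdl
      split_ifs at hdl with h₁ h₂
      · subst h₁; omega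
      · omega
      · exact hdl

end Shiftable

namespace RAM

open Program RAM.Expr

/-- The memory satisfies the invariant of the shifting phase, and array `6` holds the degrees. -/
structure ShiftState (D : ℕ → ℕ) (n N : ℕ) (s : Store) : Prop where
  n_eq : s 0 0 = n
  D_eq : s 1 = D
  N_eq : s 2 0 = N
  degree : ∀ v, s 6 v = listDegree (edge s) N v
  shiftable : Shiftable D n N (edge s)

lemma ShiftState.congr {D : ℕ → ℕ} {n N : ℕ} {s s' : Store} (h : ShiftState D n N s)
    (hs : ∀ k ≤ 6, s' k = s k) : ShiftState D n N s' := by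
  have he : edge s' = edge s :=
    edge_congr (hs 3 (by decide)) (hs 4 (by decide)) (hs 5 (by decide))
  refine ⟨?_, ?_, ?_, ?_, ?_⟩
  · rw [hs 0 (by decide), h.n_eq]
  · rw [hs 1 (by decide), h.D_eq]
  · rw [hs 2 (by decide), h.N_eq]
  · rw [hs 6 (by decide), he]
    exact h.degree
  · rw [he]
    exact h.shiftable

/-- Search a vertex whose degree is too small; store it in the scalar `17`. -/
def findUnderProgram : Program :=
  seq (write 17 (const 0) (const 0))
    (loop (not (lt (read 6 (var 17)) (read 1 (var 17)))) (write 17 (const 0) (succ (var 17))))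

lemma exec_findUnderProgram {s : Store} {n : ℕ} (h : ∃ j < n, s 6 j < s 1 j) :
    Exec findUnderProgram s (n * 20 + 20) fun s' => ∃ j < n, s' 17 0 = j ∧ s 6 j < s 1 j := by
  obtain ⟨j₀, hj₀, hunder⟩ := h
  refine (Exec.seq (T := 3) (T' := j₀ * 16 + 10) (R := fun s' => s' 17 0 = 0)
    (.of_loopFree rfl (by decide) (by simp [result])) fun s₁ hs₁ hf₁ => ?_).mono
      (by omega) fun _ => id
  have h61 : s₁ 6 = s 6 := hf₁ 6 (by decide)
  have h11 : s₁ 1 = s 1 := hf₁ 1 (by decide)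
  refine (Exec.loop (B := 6) (k := j₀)
    (fun k s' => s' 17 0 + k = j₀ ∧ s' 6 = s 6 ∧ s' 1 = s 1) ⟨by omega, h61, h11⟩ ?_).mono
      (le_of_eq rfl) ?_
  · rintro k s' ⟨hk, h6, h1⟩ - he
    simp only [ne_eq, eval_not, eval_lt, eval_read, eval_var, not_not, h6, h1] at he
    refine .of_loopFree rfl (by decide) ?_
    rcases Nat.eq_zero_or_pos k with rfl | hkpos
    · have : s' 17 0 = j₀ := by omega
      rw [this] at he
      exact absurd hunder he
    · refine ⟨k - 1, by omega, ?_, ?_, ?_⟩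
      · simp [result]
        omega
      · simp [result, h6]
      · simp [result, h1]
  · rintro s' ⟨he, k, hk, h6, h1⟩
    simp only [eval_not, eval_lt, eval_read, eval_var, not_not, ne_eq, h6, h1] at he
    exact ⟨s' 17 0, by omega, rfl, he⟩

/-- Nonzero exactly if the vertex `x` is `j` or a vertex other than `i` of the edge with index
`t`. -/
def movedMem (x i j t : Expr) : Expr := or (eq x j) (and (mem x t) (not (eq x i)))

lemma eval_movedMem (s : Store) (x i j t : Expr) :
    (movedMem x i j t).eval s ≠ 0 ↔
      x.eval s ∈ insert (j.eval s) ((edge s (t.eval s)).erase (i.eval s)) := by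
  simp only [movedMem, ne_eq, eval_or, eval_eq, eval_and, eval_mem, eval_not, mem_insert, mem_erase]
  tauto

/-- Nonzero exactly if the edge with index `u` is what the edge with index `t` becomes when it is
moved from `i` to `j`. -/
def clash (u i j t : Expr) : Expr :=
  and (movedMem (read 3 u) i j t) (and (movedMem (read 4 u) i j t) (movedMem (read 5 u) i j t))

lemma eval_clash {s : Store} {u i j t : Expr} (hu : #(edge s (u.eval s)) = 3)
    (ht : #(edge s (t.eval s)) = 3) (hi : i.eval s ∈ edge s (t.eval s)) :
    (clash u i j t).eval s ≠ 0 ↔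
      edge s (u.eval s) = insert (j.eval s) ((edge s (t.eval s)).erase (i.eval s)) := by
  have h₁ : (clash u i j t).eval s ≠ 0 ↔
      edge s (u.eval s) ⊆ insert (j.eval s) ((edge s (t.eval s)).erase (i.eval s)) := by
    simp only [clash, ne_eq, eval_and, not_or]
    rw [← ne_eq, ← ne_eq, ← ne_eq, eval_movedMem, eval_movedMem, eval_movedMem]
    conv_rhs => rw [edge]
    simp only [insert_subset_iff, singleton_subset_iff, eval_read]
  rw [h₁]
  refine ⟨fun h => eq_of_subset_of_card_le h ?_, fun h => h.subset⟩
  rw [hu]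
  refine (card_insert_le _ _).trans ?_
  rw [card_erase_of_mem hi, ht]

/-- Decide whether the edge with index in the scalar `18` can be moved from the vertex in the scalar
`16` to the vertex in the scalar `17`; set the scalar `19` to zero if so. -/
def testProgram : Program :=
  .cond (and (mem (var 16) (var 18)) (not (mem (var 17) (var 18))))
    (seq (write 19 (const 0) (const 0))
      (forLoop 20 2 (.cond (clash (var 20) (var 16) (var 17) (var 18))
        (write 19 (const 0) (const 1)) skip)))
    (write 19 (const 0) (const 1))

lemma exec_testProgram {s : Store} {N : ℕ} (hN : s 2 0 = N) (hcard : ∀ t < N, #(edge s t) = 3)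
    (ht : s 18 0 < N) :
    Exec testProgram s (N * 500 + 200)
      fun s' => s' 19 0 = 0 ↔ Movable (edge s) N (s 16 0) (s 17 0) (s 18 0) := by
  have hcost : (and (mem (var 16) (var 18)) (not (mem (var 17) (var 18)))).cost + 1 ≤ 180 := by
    decide
  have hiff : (and (mem (var 16) (var 18)) (not (mem (var 17) (var 18)))).eval s ≠ 0 ↔
      s 16 0 ∈ edge s (s 18 0) ∧ s 17 0 ∉ edge s (s 18 0) := by
    simp only [ne_eq, eval_and, eval_not, eval_mem, eval_var]
    tauto
  refine (Exec.cond (T := N * 500 + 20) (fun he => ?_) fun he => ?_).mono (by omega) fun _ => id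
  · obtain ⟨hit, hjt⟩ := hiff.1 he
    refine (Exec.seq (T := 3) (R := fun s' => s' 19 0 = 0)
      (.of_loopFree rfl (by decide) (by simp [result])) fun s₁ hs₁ hf₁ => ?_).mono
        (T := 3 + (N * (480 + 12) + 9)) (by omega) fun _ => id
    have he₁ : edge s₁ = edge s :=
      edge_congr (hf₁ 3 (by decide)) (hf₁ 4 (by decide)) (hf₁ 5 (by decide))
    have h12 : s₁ 2 = s 2 := hf₁ 2 (by decide)
    have h16 : s₁ 16 = s 16 := hf₁ 16 (by decide)
    have h17 : s₁ 17 = s 17 := hf₁ 17 (by decide)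
    have h18 : s₁ 18 = s 18 := hf₁ 18 (by decide)
    refine (Exec.forLoop (B := 480) (n := N)
      (fun k s' => s' 19 0 = 0 ↔
        ∀ u < k, edge s u ≠ insert (s 17 0) ((edge s (s 18 0)).erase (s 16 0)))
      (by rw [h12, hN]) (by decide) (by decide) (by decide) ?_ (by simpa using hs₁) ?_).mono
        le_rfl fun s' h => ?_
    · intro k s₂ s₃ hs h
      rwa [hs 19 (by decide)]
    · intro u s₂ hu hI hu₂ hf₂
      have he₂ : edge s₂ = edge s := (edge_congr (hf₂ 3 (by decide) (by decide))
        (hf₂ 4 (by decide) (by decide)) (hf₂ 5 (by decide) (by decide))).trans he₁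
      have h26 : s₂ 16 = s₁ 16 := hf₂ 16 (by decide) (by decide)
      have h27 : s₂ 17 = s₁ 17 := hf₂ 17 (by decide) (by decide)
      have h28 : s₂ 18 = s₁ 18 := hf₂ 18 (by decide) (by decide)
      have hc := eval_clash (s := s₂) (u := var 20) (i := var 16) (j := var 17) (t := var 18)
        (by rw [he₂, eval_var, hu₂]; exact hcard u hu)
        (by rw [he₂, eval_var, h28, h18]; exact hcard _ ht)
        (by rw [he₂, eval_var, eval_var, h28, h18, h26, h16]; exact hit)
      simp only [eval_var, he₂, hu₂, h26, h16, h27, h17, h28, h18] at hc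
      refine .of_loopFree rfl (by decide) ?_
      simp only [Nat.lt_succ_iff_lt_or_eq, or_imp, forall_and, forall_eq]
      by_cases hcl : (clash (var 20) (var 16) (var 17) (var 18)).eval s₂ = 0
      · rw [result, if_pos hcl]
        simp only [result, hI]
        exact ⟨fun h => ⟨h, fun h' => hc.2 h' hcl⟩, fun h => h.1⟩
      · rw [result, if_neg hcl]
        simp only [result, eval_const, and_self, if_true, one_ne_zero, false_iff, not_and]
        exact fun _ h => h (hc.1 hcl)
    · rw [h]
      exact ⟨fun h => ⟨hit, hjt, h⟩, fun h => h.2.2⟩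
  · refine .of_loopFree rfl (le_trans (by decide : _ ≤ 20) (by omega)) ?_
    simp only [result, eval_const, and_self, if_true, one_ne_zero, false_iff]
    exact fun h => hiff.2 ⟨h.1, h.2.1⟩ he

/-- Search an edge that can be moved from the vertex in the scalar `16` to the vertex in the scalar
`17`; store its index in the scalar `18`. -/
def findEdgeProgram : Program :=
  seq (write 18 (const 0) (const 0)) (seq (write 19 (const 0) (const 1))
    (loop (var 19)
      (seq testProgram (.cond (var 19) (write 18 (const 0) (succ (var 18))) skip))))

lemma exec_findEdgeProgram {s : Store} {N i j : ℕ} (hN : s 2 0 = N) (hi : s 16 0 = i)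
    (hj : s 17 0 = j) (hcard : ∀ t < N, #(edge s t) = 3)
    (hex : ∃ t < N, Movable (edge s) N i j t) :
    Exec findEdgeProgram s ((N + 1) * (N * 500 + 220) + 20)
      fun s' => ∃ t < N, s' 18 0 = t ∧ Movable (edge s) N i j t := by
  obtain ⟨t₀, ht₀, hm₀⟩ := hex
  refine (Exec.seq (T := 3) (T' := 3 + ((t₀ + 1) * (3 + (N * 500 + 210)) + 3))
    (R := fun s' => s' 18 0 = 0) (.of_loopFree rfl (by decide) (by simp [result]))
    fun s₁ hs₁ hf₁ => ?_).mono ?_ fun _ => id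
  swap
  · have : (t₀ + 1) * (3 + (N * 500 + 210)) ≤ (N + 1) * (N * 500 + 220) :=
      Nat.mul_le_mul (by omega) (by omega)
    omega
  refine Exec.seq (T := 3) (R := fun s' => s' 19 0 = 1) (.of_loopFree rfl (by decide)
    (by simp [result])) fun s₂ hs₂ hf₂ => ?_
  have hkeep : ∀ k, k ≠ 18 → k ≠ 19 → s₂ k = s k := fun k h18 h19 =>
    (hf₂ k (by simpa [writes] using h19)).trans (hf₁ k (by simpa [writes] using h18))
  have h2t : s₂ 18 = s₁ 18 := hf₂ 18 (by decide)
  -- the number of remaining iterations counts one more as long as the flag is set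
  refine (Exec.loop (B := N * 500 + 210) (k := t₀ + 1)
    (fun k s' => (s' 19 0 ≠ 0 → s' 18 0 + k = t₀ + 1 ∧ s' 18 0 ≤ t₀) ∧
      (s' 19 0 = 0 → s' 18 0 < N ∧ Movable (edge s) N i j (s' 18 0)))
    ⟨fun _ => by rw [h2t]; omega, fun h => by omega⟩ ?_).mono (le_of_eq rfl) ?_
  · rintro k s₃ ⟨hI, -⟩ hf₃ he
    obtain ⟨hk, hle⟩ := hI he
    have he₃ : edge s₃ = edge s := edge_congr
      ((hf₃ 3 (by decide)).trans (hkeep 3 (by decide) (by decide)))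
      ((hf₃ 4 (by decide)).trans (hkeep 4 (by decide) (by decide)))
      ((hf₃ 5 (by decide)).trans (hkeep 5 (by decide) (by decide)))
    have h32 : s₃ 2 0 = N := by rw [hf₃ 2 (by decide), hkeep 2 (by decide) (by decide), hN]
    have h3i : s₃ 16 0 = i := by rw [hf₃ 16 (by decide), hkeep 16 (by decide) (by decide), hi]
    have h3j : s₃ 17 0 = j := by rw [hf₃ 17 (by decide), hkeep 17 (by decide) (by decide), hj]
    refine (Exec.seq (T' := 10) (exec_testProgram h32 (by rwa [he₃]) (by omega))
      fun s₄ hs₄ hf₄ => ?_).mono le_rfl fun _ => id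
    rw [he₃, h3i, h3j] at hs₄
    have h48 : s₄ 18 = s₃ 18 := hf₄ 18 (by decide)
    refine .of_loopFree rfl (by decide) ⟨k - 1, by omega, ?_⟩
    by_cases h49 : s₄ 19 0 = 0
    · have : (Expr.var 19).eval s₄ = 0 := h49
      rw [result, if_pos this]
      simp only [result, h49, h48, ne_eq, not_true, false_imp_iff, true_and, forall_const]
      exact ⟨by omega, hs₄.1 h49⟩
    · have hnot : s₃ 18 0 ≠ t₀ := fun h => h49 (hs₄.2 (h ▸ hm₀))
      have : (Expr.var 19).eval s₄ ≠ 0 := h49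
      rw [result, if_neg this]
      simp only [result, eval_const, eval_succ, eval_var, h48, and_self, if_true]
      simp only [show (19 : ℕ) ≠ 18 by decide, if_false, h49, ne_eq, not_false_eq_true,
        forall_const, false_imp_iff, and_true]
      omega
  · rintro s' ⟨he, k, -, h⟩
    obtain ⟨hlt, hm⟩ := h he
    exact ⟨_, hlt, rfl, hm⟩

/-- Replace the vertex in the scalar `16` by that in the scalar `17` in the edge with index in the
scalar `18`. -/
def replaceProgram : Program :=
  .cond (eq (read 3 (var 18)) (var 16)) (write 3 (var 18) (var 17))
    (.cond (eq (read 4 (var 18)) (var 16)) (write 4 (var 18) (var 17))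
      (write 5 (var 18) (var 17)))

lemma result_replaceProgram {s : Store} (hit : s 16 0 ∈ edge s (s 18 0)) :
    ∃ k, (k = 3 ∨ k = 4 ∨ k = 5) ∧ s k (s 18 0) = s 16 0 ∧
      replaceProgram.result s = fun k' u => if k' = k ∧ u = s 18 0 then s 17 0 else s k' u := by
  have h3 : (eq (read 3 (var 18)) (var 16)).eval s = 0 ↔ s 3 (s 18 0) ≠ s 16 0 := by simp
  have h4 : (eq (read 4 (var 18)) (var 16)).eval s = 0 ↔ s 4 (s 18 0) ≠ s 16 0 := by simp
  simp only [edge, mem_insert, mem_singleton] at hit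
  by_cases h3i : s 3 (s 18 0) = s 16 0
  · refine ⟨3, by simp, h3i, ?_⟩
    rw [replaceProgram, result, if_neg fun h => h3.1 h h3i]
    rfl
  · by_cases h4i : s 4 (s 18 0) = s 16 0
    · refine ⟨4, by simp, h4i, ?_⟩
      rw [replaceProgram, result, if_pos (h3.2 h3i), result, if_neg fun h => h4.1 h h4i]
      rfl
    · refine ⟨5, by simp, by tauto, ?_⟩
      rw [replaceProgram, result, if_pos (h3.2 h3i), result, if_pos (h4.2 h4i)]
      rfl

lemma exec_replaceProgram {s : Store} {i j t : ℕ} (hi : s 16 0 = i) (hj : s 17 0 = j)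
    (ht : s 18 0 = t) (hcard : #(edge s t) = 3) (hit : i ∈ edge s t) :
    Exec replaceProgram s 60 fun s' => (∀ u ≠ t, edge s' u = edge s u) ∧
      edge s' t = insert j ((edge s t).erase i) := by
  subst hi hj ht
  obtain ⟨h34, h35, h45⟩ := edge_ne_of_card hcard
  obtain ⟨k, hk, hki, hres⟩ := result_replaceProgram hit
  refine .of_loopFree rfl (by decide) ?_
  rw [hres]
  refine ⟨fun u hu => by simp [edge, hu], ?_⟩
  ext w
  rcases hk with rfl | rfl | rfl <;>
    simp only [edge, mem_insert, mem_singleton, mem_erase, ← hki] <;> grind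

/-- Move the edge with index in the scalar `18` from the vertex in the scalar `16` to that in the
scalar `17`, and update the degrees. -/
def moveProgram : Program :=
  seq replaceProgram (seq (write 6 (var 16) (sub (read 6 (var 16)) (const 1)))
    (write 6 (var 17) (succ (read 6 (var 17)))))

lemma exec_moveProgram {s : Store} {i j t : ℕ} (hi : s 16 0 = i)
    (hj : s 17 0 = j) (ht : s 18 0 = t) (hcard : #(edge s t) = 3) (hit : i ∈ edge s t)
    (hjt : j ∉ edge s t) :
    Exec moveProgram s 100 fun s' => (∀ u ≠ t, edge s' u = edge s u) ∧
      edge s' t = insert j ((edge s t).erase i) ∧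
      ∀ v, s' 6 v = if v = i then s 6 v - 1 else if v = j then s 6 v + 1 else s 6 v := by
  have hij : i ≠ j := fun h => hjt (h ▸ hit)
  refine (exec_replaceProgram hi hj ht hcard hit).seq (T' := 40) fun s₁ ⟨hE, hEt⟩ hf => ?_
  have h6 : s₁ 6 = s 6 := hf 6 (by decide)
  have hi₁ : s₁ 16 0 = i := by rw [hf 16 (by decide), hi]
  have hj₁ : s₁ 17 0 = j := by rw [hf 17 (by decide), hj]
  refine (Exec.of_loopFree (Q := fun s' => s' = _) rfl (by decide) rfl).frame.mono le_rfl ?_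
  rintro s₂ ⟨hs₂, hf₂⟩
  rw [edge_congr (hf₂ 3 (by decide)) (hf₂ 4 (by decide)) (hf₂ 5 (by decide))]
  refine ⟨hE, hEt, fun v => ?_⟩
  rw [hs₂]
  simp only [result, eval_var, hi₁, hj₁, eval_sub, eval_read, eval_const, eval_succ, h6, true_and,
    show (17 : ℕ) ≠ 6 by decide, false_and, if_false]
  by_cases hvi : v = i
  · subst hvi
    simp [hij]
  · by_cases hvj : v = j
    · subst hvj
      simp [hvi]
    · simp [hvi, hvj]

/-- Move edges from vertices of too large degree to vertices of too small degree until all degrees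
are right. -/
def shiftProgram : Program :=
  forLoop 16 0 (loop (lt (read 1 (var 16)) (read 6 (var 16)))
    (seq findUnderProgram (seq findEdgeProgram moveProgram)))

/-- A bound on the running time of a single shift. -/
def shiftCost (n N : ℕ) : ℕ := n * 20 + 20 + ((N + 1) * (N * 500 + 220) + 20 + 100)

lemma exec_shiftProgram {s : Store} {D : ℕ → ℕ} {n N : ℕ} (h : ShiftState D n N s) :
    Exec shiftProgram s (n * (N * (8 + shiftCost n N) + 20) + 9)
      fun s' => ShiftState D n N s' ∧ ∀ v < n, s' 6 v = D v := by
  refine (Exec.forLoop (B := N * (8 + shiftCost n N) + 8)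
    (fun i s' => ShiftState D n N s' ∧ ∀ v < i, s' 6 v ≤ D v) h.n_eq (by decide) (by decide)
    (by decide) ?_ ⟨h, by simp⟩ ?_).mono le_rfl ?_
  · rintro i s₁ s₂ hs ⟨h₁, h₂⟩
    refine ⟨h₁.congr fun k hk => hs k (by omega), ?_⟩
    rwa [hs 6 (by decide)]
  · rintro i s₁ hin ⟨h₁, hle₁⟩ hi₁ -
    refine (Exec.loop (B := shiftCost n N) (k := N)
      (fun k s' => ShiftState D n N s' ∧ (∀ v < i, s' 6 v ≤ D v) ∧ s' 6 i ≤ D i + k)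
      ⟨h₁, hle₁, ?_⟩ ?_).frame.mono ?_ ?_
    · rw [h₁.degree]
      exact (listDegree_le _ _ _).trans (by omega)
    · rintro k s₂ ⟨h₂, hle₂, hk⟩ hf₂ he
      have hi₂ : s₂ 16 0 = i := by rw [hf₂ 16 (by decide), hi₁]
      simp only [ne_eq, eval_lt, eval_read, eval_var, not_not, hi₂, h₂.D_eq] at he
      have hdi : D i < listDegree (edge s₂) N i := by rwa [← h₂.degree]
      refine Exec.seq (exec_findUnderProgram (n := n) ?_) fun s₃ hs₃ hf₃ => ?_
      · obtain ⟨j, hj, hdj⟩ := h₂.shiftable.exists_under hin hdi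
        exact ⟨j, hj, by rwa [h₂.degree, h₂.D_eq]⟩
      obtain ⟨j, hjn, hj₃, hdj⟩ := hs₃
      have h₃ : ShiftState D n N s₃ := h₂.congr fun k hk => hf₃ k (by
        simp [findUnderProgram, writes]; omega)
      have hi₃ : s₃ 16 0 = i := by rw [hf₃ 16 (by decide), hi₂]
      have h36 : s₃ 6 = s₂ 6 := hf₃ 6 (by decide)
      rw [← h36, h₃.degree, h₂.D_eq] at hdj
      rw [← h₂.degree, ← h36, h₃.degree] at hdi
      refine Exec.seq (exec_findEdgeProgram h₃.N_eq hi₃ hj₃ h₃.shiftable.card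
        (h₃.shiftable.exists_movable hin hjn hdi hdj)) fun s₄ hs₄ hf₄ => ?_
      obtain ⟨t, ht, ht₄, hm⟩ := hs₄
      have h₄ : ShiftState D n N s₄ := h₃.congr fun k hk => hf₄ k (by
        simp [findEdgeProgram, testProgram, forLoop, writes]; omega)
      have h46 : s₄ 6 = s₃ 6 := hf₄ 6 (by decide)
      have he₄ : edge s₄ = edge s₃ :=
        edge_congr (hf₄ 3 (by decide)) (hf₄ 4 (by decide)) (hf₄ 5 (by decide))
      rw [← he₄] at hm hdi hdj
      refine (exec_moveProgram (by rw [hf₄ 16 (by decide), hi₃]) (by rw [hf₄ 17 (by decide), hj₃])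
        ht₄ (h₄.shiftable.card t ht) hm.1 hm.2.1).frame.mono le_rfl ?_
      rintro s₅ ⟨⟨hE, hEt, h56⟩, hf₅⟩
      have h₅ := h₄.shiftable.move hjn ht hm hdi hdj hE hEt
      have hdeg := hm.listDegree ht hE hEt
      have hk' : s₂ 6 i ≤ D i + k := hk
      rw [← h36, ← h46] at hk'
      rw [← h₄.degree] at hdi hdj
      refine ⟨k - 1, by omega, ⟨?_, ?_, ?_, ?_, h₅⟩, ?_, ?_⟩
      · rw [hf₅ 0 (by decide), h₄.n_eq]
      · rw [hf₅ 1 (by decide), h₄.D_eq]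
      · rw [hf₅ 2 (by decide), h₄.N_eq]
      · intro v
        rw [h56, hdeg, h₄.degree]
      · intro v hv
        have := hle₂ v hv
        rw [← h36, ← h46] at this
        rw [h56]
        split_ifs with hvi hvj
        · omega
        · subst hvj; omega
        · exact this
      · rw [h56, if_pos rfl]
        omega
    · have : (lt (read 1 (var 16)) (read 6 (var 16))).cost = 7 := rfl
      rw [this]
    · rintro s₂ ⟨⟨he, k, h₂, hle₂, -⟩, hf₂⟩
      have hi₂ : s₂ 16 0 = i := by rw [hf₂ 16 (by decide), hi₁]
      simp only [eval_lt, eval_read, eval_var, hi₂, h₂.D_eq, not_lt] at he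
      refine ⟨h₂, fun v hv => ?_⟩
      rcases Nat.lt_succ_iff_lt_or_eq.1 hv with hv | rfl
      · exact hle₂ v hv
      · exact he
  · rintro s' ⟨h', hle⟩
    refine ⟨h', fun v hv => ?_⟩
    have hsum : ∑ v ∈ range n, s' 6 v = ∑ v ∈ range n, D v := by
      rw [h'.shiftable.sum, ← sum_listDegree h'.shiftable.card h'.shiftable.sub]
      exact sum_congr rfl fun v _ => h'.degree v
    exact (sum_eq_sum_iff_of_le fun v hv => hle v (mem_range.1 hv)).1 hsum v (mem_range.2 hv)

end RAM

/-! ### The hypergraph of a list of edges, and the whole program -/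

lemma FloorBounds.exists_degreeBounds {n : ℕ} {d : Fin n → ℕ} (hn : 45 ≤ n)
    (h : FloorBounds d ∨ SimpleBounds d) {D : ℕ → ℕ} (hD : ∀ v : Fin n, D v = d v) :
    ∃ m, DegreeBounds D n m :=
  ⟨_, FloorBounds.degreeBounds hn (h.elim id (SimpleBounds.floorBounds hn)) hD⟩

namespace RAM

open Program RAM.Expr

/-- The hypergraph formed by the first `N` listed edges. -/
def toHypergraph (n N : ℕ) (s : Store) : Hypergraph (Fin n) where
  vertexSet := Set.univ
  edgeSet := Set.range fun t : Fin N => {v : Fin n | (v : ℕ) ∈ edge s t}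
  subset_vertexSet_of_mem_edgeSet' := fun _ _ => Set.subset_univ _

section

variable {D : ℕ → ℕ} {n N : ℕ} {s : Store}

lemma image_val_edge (h : Shiftable D n N (edge s)) (t : Fin N) :
    Fin.val '' {v : Fin n | (v : ℕ) ∈ edge s t} = edge s t := by
  ext v
  simp only [Set.mem_image, Set.mem_ofPred_eq, mem_coe]
  refine ⟨?_, fun hv => ⟨⟨v, mem_range.1 (h.sub t t.2 hv)⟩, hv, rfl⟩⟩
  rintro ⟨w, hw, rfl⟩
  exact hw

lemma injective_edge (h : Shiftable D n N (edge s)) :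
    Function.Injective fun t : Fin N => {v : Fin n | (v : ℕ) ∈ edge s t} := by
  intro t u htu
  have := congrArg (Set.image Fin.val) htu
  simp only [image_val_edge h, coe_inj] at this
  exact Fin.ext (h.inj t t.2 u u.2 this)

lemma holds_toHypergraph (h : Shiftable D n N (edge s)) (hN : s 2 0 = N) :
    Holds s (toHypergraph n N s) := by
  subst hN
  refine ⟨_, injective_edge h, rfl, fun t => ?_⟩
  rw [image_val_edge h]
  simp [edge]

lemma isRealization_toHypergraph (h : Shiftable D n N (edge s)) {d : Fin n → ℕ}
    (hd : ∀ v : Fin n, listDegree (edge s) N v = d v) :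
    IsRealization d (toHypergraph n N s) := by
  refine ⟨rfl, ?_, fun v => ?_⟩
  · rintro _ ⟨t, rfl⟩
    rw [← Set.ncard_image_of_injective _ Fin.val_injective, image_val_edge h, Set.ncard_coe_finset,
      h.card t t.2]
  · have : {e ∈ (toHypergraph n N s).edgeSet | v ∈ e} =
        (fun t : Fin N => {v : Fin n | (v : ℕ) ∈ edge s t}) '' {t | (v : ℕ) ∈ edge s t} := by
      ext e
      constructor
      · rintro ⟨⟨t, rfl⟩, ht⟩
        exact ⟨t, ht, rfl⟩
      · rintro ⟨t, ht, rfl⟩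
        exact ⟨⟨t, rfl⟩, ht⟩
    rw [this, Set.ncard_image_of_injective _ (injective_edge h), ← hd v,
      ← Set.ncard_image_of_injective _ Fin.val_injective, listDegree, ← Set.ncard_coe_finset]
    congr 1
    ext t
    simp only [Set.mem_image, Set.mem_ofPred_eq, mem_coe, mem_filter, mem_range]
    constructor
    · rintro ⟨t, ht, rfl⟩
      exact ⟨t.2, ht⟩
    · rintro ⟨ht, ht'⟩
      exact ⟨⟨t, ht⟩, ht', rfl⟩

end

/-- The program that constructs a realization. -/
def realizationProgram : Program :=
  seq sumProgram (seq sortProgram (seq colexProgram (seq degreeProgram shiftProgram)))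

/-- A bound on the running time of `realizationProgram` on `n` vertices. -/
noncomputable def realizationCost : Polynomial ℕ :=
  (.X * 30 + 9) + ((.X * (.X * 60 + 40) + 9) + ((.X * (.X * (.X * 80 + 30) + 30) + 9) +
    ((.X ^ 3 * 50 + 9) + (.X * (.X ^ 3 * (8 + (.X * 20 + 20 +
      ((.X ^ 3 + 1) * (.X ^ 3 * 500 + 220) + 20 + 100))) + 20) + 9))))

lemma eval_realizationCost (n : ℕ) : realizationCost.eval n =
    (n * 30 + 9) + ((n * (n * 60 + 40) + 9) + ((n * (n * (n * 80 + 30) + 30) + 9) +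
      ((n ^ 3 * 50 + 9) + (n * (n ^ 3 * (8 + shiftCost n (n ^ 3)) + 20) + 9)))) := by
  simp [realizationCost, shiftCost]

lemma exec_realizationProgram {n : ℕ} {d : Fin n → ℕ} {m : ℝ}
    (hD : DegreeBounds (input d 1) n m) (h3 : 3 ∣ ∑ v, d v) :
    Exec realizationProgram (input d) (realizationCost.eval n)
      fun s => ∃ N, ShiftState (input d 1) n N s ∧ ∀ v < n, s 6 v = input d 1 v := by
  have hsum : ∑ v ∈ range n, input d 1 v = ∑ v, d v := by
    rw [Finset.sum_range]
    exact sum_congr rfl fun v _ => by simp [input]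
  rw [eval_realizationCost]
  refine (exec_sumProgram (n := n) rfl rfl).seq fun s₁ hs₁ hf₁ => ?_
  have h11 : s₁ 1 = input d 1 := hf₁ 1 (by decide)
  have h10 : s₁ 0 = input d 0 := hf₁ 0 (by decide)
  have h12 : s₁ 2 = input d 2 := hf₁ 2 (by decide)
  have h16 : s₁ 6 = input d 6 := hf₁ 6 (by decide)
  refine (exec_sortProgram (n := n) (by rw [h10]; rfl)).seq fun s₂ hs₂ hf₂ => ?_
  have h21 : s₂ 1 = s₁ 1 := hf₂ 1 (by decide)
  have h20 : s₂ 0 = s₁ 0 := hf₂ 0 (by decide)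
  have h22 : s₂ 2 = s₁ 2 := hf₂ 2 (by decide)
  have h26 : s₂ 6 = s₁ 6 := hf₂ 6 (by decide)
  have h28 : s₂ 8 = s₁ 8 := hf₂ 8 (by decide)
  rw [h11] at hs₂
  refine (exec_colexProgram (n := n) (by rw [h20, h10]; rfl) (by rw [h22, h12]; rfl)
    (by rw [h28, hs₁]) (by rwa [hsum]) hs₂.inj).seq fun s₃ hs₃ hf₃ => ?_
  have h31 : s₃ 1 = s₂ 1 := hf₃ 1 (by decide)
  have h30 : s₃ 0 = s₂ 0 := hf₃ 0 (by decide)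
  have h36 : s₃ 6 = s₂ 6 := hf₃ 6 (by decide)
  have hsh := Shiftable.of_colexPrefix hD hs₂ (by rwa [hsum]) hs₃
  have hN : s₃ 2 0 ≤ n ^ 3 := by
    have := card_le_choose_of_subset hsh.inj hsh.card hsh.sub
    rw [card_range] at this
    exact this.trans (Nat.choose_le_pow n 3)
  refine ((exec_degreeProgram rfl (fun v => by rw [h36, h26, h16]; rfl) hsh.card).seq
    fun s₄ hs₄ hf₄ => ?_).mono (T := s₃ 2 0 * 50 + 9 +
      (n * (s₃ 2 0 * (8 + shiftCost n (s₃ 2 0)) + 20) + 9)) ?_ fun _ => id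
  · have h41 : s₄ 1 = s₃ 1 := hf₄ 1 (by decide)
    have h40 : s₄ 0 = s₃ 0 := hf₄ 0 (by decide)
    have h42 : s₄ 2 = s₃ 2 := hf₄ 2 (by decide)
    have he₄ : edge s₄ = edge s₃ :=
      edge_congr (hf₄ 3 (by decide)) (hf₄ 4 (by decide)) (hf₄ 5 (by decide))
    have hstate : ShiftState (input d 1) n (s₃ 2 0) s₄ := by
      refine ⟨?_, ?_, by rw [h42], by rwa [he₄], by rwa [he₄]⟩
      · rw [h40, h30, h20, h10]; rfl
      · rw [h41, h31, h21, h11]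
    exact (exec_shiftProgram hstate).mono le_rfl fun s' h => ⟨_, h⟩
  · unfold shiftCost
    gcongr

/-- The program computes a realization of every sequence within the bounds in polynomial time. -/
lemma exists_run_realizationProgram {n : ℕ} {d : Fin n → ℕ} (hn : 45 ≤ n) (h3 : 3 ∣ ∑ v, d v)
    (h : FloorBounds d ∨ SimpleBounds d) :
    ∃ (s : Store) (t : ℕ) (H : Hypergraph (Fin n)), Run realizationProgram (input d) s t ∧
      t ≤ realizationCost.eval n ∧ Holds s H ∧ IsRealization d H := by
  have hin : ∀ v : Fin n, input d 1 v = d v := fun v => by simp [input]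
  obtain ⟨m, hD⟩ := FloorBounds.exists_degreeBounds hn h hin
  obtain ⟨s, t, hr, ht, N, hs, hdeg⟩ := exec_realizationProgram hD h3
  refine ⟨s, t, toHypergraph n N s, hr, ht, holds_toHypergraph hs.shiftable hs.N_eq,
    isRealization_toHypergraph hs.shiftable fun v => ?_⟩
  rw [← hs.degree, hdeg v v.2, hin]

end RAM

theorem mainTheorem1 :
    -- existence, with the exact bounds
    (∀ (n : ℕ) (d : Fin n → ℕ), 45 ≤ n → 3 ∣ ∑ v, d v → FloorBounds d → IsGraphic d) ∧
    -- existence, with the simpler bounds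
    (∀ (n : ℕ) (d : Fin n → ℕ), 45 ≤ n → 3 ∣ ∑ v, d v → SimpleBounds d → IsGraphic d) ∧
    -- one program constructs a realization of every such sequence in polynomial time
    (∃ (P : RAM.Program) (T : Polynomial ℕ), ∀ (n : ℕ) (d : Fin n → ℕ),
      45 ≤ n → 3 ∣ ∑ v, d v → FloorBounds d ∨ SimpleBounds d →
        ∃ (s : RAM.Store) (t : ℕ) (H : Hypergraph (Fin n)),
          RAM.Run P (RAM.input d) s t ∧ t ≤ T.eval n ∧ RAM.Holds s H ∧ IsRealization d H) := by
  refine ⟨fun n d hn h3 h => ?_, fun n d hn h3 h => ?_,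
    RAM.realizationProgram, RAM.realizationCost, fun n d hn h3 h =>
      RAM.exists_run_realizationProgram hn h3 h⟩
  · obtain ⟨s, t, H, -, -, -, hH⟩ := RAM.exists_run_realizationProgram hn h3 (Or.inl h)
    exact ⟨H, hH⟩
  · obtain ⟨s, t, H, -, -, -, hH⟩ := RAM.exists_run_realizationProgram hn h3 (Or.inr h)
    exact ⟨H, hH⟩
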